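/- Let $\mathbb K\in\{\mathbb R,\mathbb C\}$. Let $X$ be a topological space with a countable $\pi$-base, i.e. a sequence $(U_n)_{n\in\mathbb N}$ of nonempty open sets such that every nonempty open set contains some $U_n$. Let $\mu$ be a positive Borel measure on $X$ and let $0<p<\infty$. Write $L^q=L^q(X,\mu;\mathbb K)$ and equip $L^p$ with the topology given by the (quasi-)norm $\|\cdot\|_p$. For $0<q\le\infty$, a $\mathbb K$-valued function $f$ on $X$ is *nowhere $L^q$* if $f|_U\notin L^q(U)$ for every nonempty open $U\subset X$. Put $$S_p=\{f\in L^p: f\text{ is nowhere }L^q\text{ for every }p<q\le\infty\},\qquad S'_p=S_p\setminus\bigcup_{0<q<p}L^q,$$ $$\mathcal G=\Big\{f\in\bigcap_{0<q<\infty}L^q: f\text{ is nowhere }L^\infty\Big\}.$$ The measure $\mu$ is *atomless* if every Borel set $A$ with $\mu(A)>0$ contains a Borel set $B$ with $0<\mu(B)<\mu(A)$; it is *outer regular* if $\mu(A)=\inf\{\mu(V):V\supset A\text{ open}\}$ for every Borel set $A$; it has *full support* if $\mu(U)>0$ for every nonempty open $U$. A linear subspace of $L^p$ is *$\ell_p$-isometric*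 if it is the image of $\ell_p$ (over $\mathbb K$) under a linear map preserving $\|\cdot\|_p$; it is *complemented* if it is the range of a continuous linear projection of $L^p$. (a) If $\mu$ is atomless, outer regular and has full support, then $S_p\cup\{0\}$ contains an $\ell_p$-isometric subspace of $L^p$, which is in addition complemented in $L^p$ if $p\ge1$. (b) If $\mu$ is infinite and $\sigma$-finite, then $\big(L^p\setminus\bigcup_{0<q<p}L^q\big)\cup\{0\}$ contains an $\ell_p$-isometric subspace of $L^p$, which is in addition complemented in $L^p$ if $p\ge1$. (c) If $\mu$ is atomless, infinite, outer regular and has full support, then $S'_p\cup\{0\}$ contains an $\ell_p$-isometric subspace of $L^p$, which is in addition complemented in $L^p$ if $p\ge1$. (d) If $\mu$ is atomless, outer regular and has full support, and $L^p$ has a dense subset of cardinality at most $\mathfrak c$ (for instance, if $L^p$ is separable), then $S_p$ is maximal-dimension dense-lineable: $S_p\cup\{0\}$ contains a dense infinite-dimensional linear subspace of $L^p$ whose (algebraic) dimension equals that of $L^p$. (e) If $\mu$ is atomless, outer regular and has full support, then $\mathcal G$ is strongly $\mathfrak c$-algebrable: in the algebra of $\mathbb K$-valued measurable functions modulo equality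 almost everywhere there is a set $Z$ of cardinality $\mathfrak c$ such that no nonzero polynomial over $\mathbb K$ vanishes at distinct elements of $Z$, and the algebra generated by $Z$ (the set of all values at elements of $Z$ of polynomials without constant term) is contained in $\mathcal G\cup\{0\}$. -/

import Mathlib

open MeasureTheory Set
open scoped ENNReal Cardinal

namespace NowhereLq

/-- A countable `π`-base: a sequence of nonempty open sets such that every nonempty open set
contains one of its members. (In particular the space is nonempty.) -/
def HasCountablePiBase (X : Type*) [TopologicalSpace X] : Prop :=
  ∃ U : ℕ → Set X, (∀ n, IsOpen (U n) ∧ (U n).Nonempty) ∧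
    ∀ A : Set X, IsOpen A → A.Nonempty → ∃ n, U n ⊆ A

/-- A measure is atomless if it has no atoms: every measurable set of positive measure contains a
measurable set of strictly smaller positive measure. -/
def IsAtomless {X : Type*} [MeasurableSpace X] (μ : Measure X) : Prop :=
  ∀ A : Set X, MeasurableSet A → 0 < μ A → ∃ B ⊆ A, MeasurableSet B ∧ 0 < μ B ∧ μ B < μ A

section Algebra

variable {X : Type*} [MeasurableSpace X] {𝕜 : Type*} [RCLike 𝕜] {μ : Measure X}

/-- The classes of measurable functions modulo almost everywhere equality form a commutative ring
under the pointwise operations. -/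
instance instCommRingAEEqFun : CommRing (X →ₘ[μ] 𝕜) where
  __ := (inferInstance : AddCommGroup (X →ₘ[μ] 𝕜))
  __ := (inferInstance : CommMonoid (X →ₘ[μ] 𝕜))
  left_distrib f g h := AEEqFun.toGerm_injective (by
    simp only [AEEqFun.mul_toGerm, AEEqFun.add_toGerm, mul_add])
  right_distrib f g h := AEEqFun.toGerm_injective (by
    simp only [AEEqFun.mul_toGerm, AEEqFun.add_toGerm, add_mul])
  zero_mul f := AEEqFun.toGerm_injective (by
    simp only [AEEqFun.mul_toGerm, AEEqFun.zero_toGerm, zero_mul])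
  mul_zero f := AEEqFun.toGerm_injective (by
    simp only [AEEqFun.mul_toGerm, AEEqFun.zero_toGerm, mul_zero])

/-- The algebra structure over the scalar field, with the pointwise scalar multiplication. -/
instance instAlgebraAEEqFun : Algebra 𝕜 (X →ₘ[μ] 𝕜) :=
  Algebra.ofModule
    (fun c f g => AEEqFun.induction_on₂ f g fun f hf g hg => by
      rw [AEEqFun.smul_mk, AEEqFun.mk_mul_mk, AEEqFun.mk_mul_mk, AEEqFun.smul_mk,
        AEEqFun.mk_eq_mk, smul_mul_assoc])
    (fun c f g => AEEqFun.induction_on₂ f g fun f hf g hg => by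
      rw [AEEqFun.smul_mk, AEEqFun.mk_mul_mk, AEEqFun.mk_mul_mk, AEEqFun.smul_mk,
        AEEqFun.mk_eq_mk, mul_smul_comm])

end Algebra

section Functions

variable {X : Type*} [TopologicalSpace X] [MeasurableSpace X] (𝕜 : Type*) [RCLike 𝕜]

/-- `f` is nowhere `L^q`: its restriction to any nonempty open set `U` is not in `L^q(U)`. -/
def IsNowhereLq {𝕜 : Type*} [RCLike 𝕜] (f : X → 𝕜) (q : ℝ≥0∞) (μ : Measure X) : Prop :=
  ∀ U : Set X, IsOpen U → U.Nonempty → ¬ MemLp f q (μ.restrict U)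

/-- `S_p`: the functions in `L^p` that are nowhere `L^q` for every `p < q ≤ ∞`. -/
def S (p : ℝ≥0∞) (μ : Measure X) : Set (Lp 𝕜 p μ) :=
  {f | ∀ q : ℝ≥0∞, p < q → IsNowhereLq f q μ}

/-- The set of the functions in `L^p` that lie in no `L^q` with `0 < q < p`. -/
def LpDiffLower {X : Type*} [MeasurableSpace X] (𝕜 : Type*) [RCLike 𝕜] (p : ℝ≥0∞)
    (μ : Measure X) : Set (Lp 𝕜 p μ) :=
  {f | ∀ q : ℝ≥0∞, 0 < q → q < p → ¬ MemLp f q μ}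

/-- `S'_p`: the functions in `S_p` that lie in no `L^q` with `0 < q < p`. -/
def S' (p : ℝ≥0∞) (μ : Measure X) : Set (Lp 𝕜 p μ) :=
  {f | f ∈ S 𝕜 p μ ∧ ∀ q : ℝ≥0∞, 0 < q → q < p → ¬ MemLp f q μ}

/-- The set, in the algebra of (classes of) measurable functions, of those that are in `L^q` for
every `0 < q < ∞` and are nowhere `L^∞`. -/
def G (μ : Measure X) : Set (X →ₘ[μ] 𝕜) :=
  {f | (∀ q : ℝ≥0∞, 0 < q → q < ∞ → MemLp f q μ) ∧ IsNowhereLq f ∞ μ}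

end Functions

section Structures

variable {X : Type*} [MeasurableSpace X] {𝕜 : Type*} [RCLike 𝕜] {p : ℝ≥0∞} {μ : Measure X}

/-- The subspace `E` of `L^p` is isometric to `ℓ_p`: there is a linear bijection of `ℓ_p` onto `E`
preserving the (quasi-)norm `‖·‖_p`. -/
def IsIsometricToSeqSpace (E : Submodule 𝕜 (Lp 𝕜 p μ)) : Prop :=
  ∃ e : lp (fun _ : ℕ => 𝕜) p ≃ₗ[𝕜] E, ∀ a, ‖(e a : Lp 𝕜 p μ)‖ = ‖a‖

/-- `A ∪ {0}` contains a subspace of `L^p` isometric to `ℓ_p` which, if `p ≥ 1`, is complemented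
in the Banach space `L^p` (it is the range of a continuous linear projection). -/
def ContainsSeqSpace (A : Set (Lp 𝕜 p μ)) : Prop :=
  ∃ E : Submodule 𝕜 (Lp 𝕜 p μ), (E : Set (Lp 𝕜 p μ)) ⊆ A ∪ {0} ∧ IsIsometricToSeqSpace E ∧
    ∀ _ : Fact (1 ≤ p), E.ClosedComplemented

/-- Density of a subset of `L^p`, `0 < p < ∞`, for the topology given by `‖f - g‖_p`. -/
def IsDenseInLp (D : Set (Lp 𝕜 p μ)) : Prop :=
  ∀ f : Lp 𝕜 p μ, ∀ ε : ℝ, 0 < ε → ∃ g ∈ D, ‖f - g‖ < ε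

/-- `A ∪ {0}` contains a dense infinite-dimensional vector subspace of `L^p` whose dimension is
that of `L^p`. -/
def IsMaximalDimensionDenseLineable (A : Set (Lp 𝕜 p μ)) : Prop :=
  ∃ W : Submodule 𝕜 (Lp 𝕜 p μ), (W : Set (Lp 𝕜 p μ)) ⊆ A ∪ {0} ∧
    IsDenseInLp (W : Set (Lp 𝕜 p μ)) ∧ ℵ₀ ≤ Module.rank 𝕜 W ∧
    Module.rank 𝕜 W = Module.rank 𝕜 (Lp 𝕜 p μ)

end Structures

/-- Strong `κ`-algebrability of a subset `A` of a commutative algebra: there is a set `Z` of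
cardinality `κ` of free generators (no nonzero polynomial vanishes at distinct elements of `Z`)
such that the algebra generated by `Z` (the polynomials in elements of `Z` without constant term)
is contained in `A ∪ {0}`. -/
def IsStronglyAlgebrable (𝕜 : Type*) [Field 𝕜] {R : Type*} [CommRing R] [Algebra 𝕜 R]
    (κ : Cardinal) (A : Set R) : Prop :=
  ∃ Z : Set R, #Z = κ ∧ AlgebraicIndependent 𝕜 ((↑) : Z → R) ∧
    (NonUnitalAlgebra.adjoin 𝕜 Z : Set R) ⊆ A ∪ {0}

end NowhereLq

/-!
All parts come from one construction: a countable disjoint family of measurable cells whose measures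
are controlled, and functions that are constant on each cell.

In an atomless measure every sequence of sets of positive measure, such as the members of the
`π`-base with repetitions, has a disjoint refinement by cells of measure as small as desired
(`IsAtomless.exists_disjoint_le`). Dually, a set of infinite measure contains disjoint cells of
arbitrarily large finite measure as soon as the measure is semifinite (`exists_disjoint_ge`).

For the copies of `ℓ_p`, the cells `D (k, i)` of the `k`-th block carry a function whose `p`-th power
has integral `2⁻¹ ^ (i + 1)` on `D (k, i)`. Block functions are disjointly supported unit vectors, so
they span `ℓ_p` isometrically (`blockEmbedding`). The coefficients are recovered from the means over
the cells `D (k, 0)`, each of which carries half of the norm power of its block; for `p ≥ 1` Hölder's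
inequality makes this a bounded projection (`closedComplemented_range`). On a cell of measure at most
`2⁻¹ ^ i ^ 2` this normalization forces values so large that the `L^q` norms over such cells are
unbounded for every `q > p`; over cells of measure at least `2 ^ i ^ 2` they are unbounded for every
`q < p`. Small cells of each block in every open set give functions that are nowhere `L^q`
(`isNowhereLq_of_isFine`), large cells give functions outside `L^q` (`not_memLp_of_isCoarse`), and the
even and odd cells of a block can be used for the two purposes at once.

The property of being nowhere `L^q` for `q > p` persists when a bounded function is added to a nonzero
block sum. Hence perturbing a dense family of bounded functions by small multiples of the `𝔠` linearly
independent block sums with geometric coefficients yields a dense subspace of dimension `𝔠`, which is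
the largest possible since `L^p` has at most `𝔠` elements (`isMaximalDimensionDenseLineable_S`).

For the algebra, let `u` be equal to `n` on a cell `D n` of measure at most `2⁻¹ ^ n ^ 2`, with cells of
arbitrarily large index in every open set. The functions `exp (s u)`, `s > 0`, extended by zero, lie in
every `L^q` with `q < ∞`. In a combination of finitely many of them the largest exponent dominates, so
it is unbounded in every open set. With exponents from a Hamel basis of `ℝ` over `ℚ`, distinct
monomials have distinct exponents, and the generators are free (`isStronglyAlgebrable_G`).
-/

namespace NowhereLq

/-! ### Functions that are constant on the cells of a countable disjoint family -/

section Cells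

variable {X J : Type*} {D : J → Set X}

open Classical in
/-- The label of the cell `D j` containing a point, and `none` for a point outside all the cells.
A function that is constant on every cell and on the complement of their union is a composition
`v ∘ cellIndex D`; sums and products of such functions are computed on the values `v`. -/
noncomputable def cellIndex (D : J → Set X) (x : X) : Option J :=
  if h : ∃ j, x ∈ D j then some h.choose else none

theorem cellIndex_of_mem (hd : Pairwise (Function.onFun Disjoint D)) {x : X} {j : J}
    (hx : x ∈ D j) : cellIndex D x = some j := by
  have h : ∃ j, x ∈ D j := ⟨j, hx⟩
  rw [cellIndex, dif_pos h]
  by_contra hne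
  have hne' : h.choose ≠ j := fun e => hne (by rw [e])
  exact Set.disjoint_left.1 (hd hne') h.choose_spec hx

theorem cellIndex_of_forall_notMem {x : X} (hx : ∀ j, x ∉ D j) : cellIndex D x = none := by
  rw [cellIndex, dif_neg (by simpa using hx)]

theorem comp_cellIndex_eq_tsum (hd : Pairwise (Function.onFun Disjoint D)) {F : Option J → ℝ≥0∞}
    (h0 : F none = 0) (x : X) :
    F (cellIndex D x) = ∑' j, (D j).indicator (fun _ => F (some j)) x := by
  by_cases h : ∃ j, x ∈ D j
  · obtain ⟨j, hj⟩ := h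
    rw [cellIndex_of_mem hd hj, tsum_eq_single j, indicator_of_mem hj]
    intro i hij
    exact indicator_of_notMem (fun hi => Set.disjoint_left.1 (hd hij) hi hj) _
  · push Not at h
    rw [cellIndex_of_forall_notMem h, h0]
    simp [h]

variable [MeasurableSpace X] [Countable J]

theorem measurable_comp_cellIndex (hD : ∀ j, MeasurableSet (D j))
    (hd : Pairwise (Function.onFun Disjoint D)) {Y : Type*} [MeasurableSpace Y]
    (v : Option J → Y) : Measurable fun x => v (cellIndex D x) := by
  let _ : MeasurableSpace (Option J) := ⊤
  refine (measurable_from_top (f := v)).comp (measurable_to_countable' fun o => ?_)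
  cases o with
  | none =>
    have : cellIndex D ⁻¹' {none} = (⋃ j, D j)ᶜ := by
      ext x
      simp only [mem_preimage, mem_singleton_iff, mem_compl_iff, mem_iUnion]
      refine ⟨?_, fun h => cellIndex_of_forall_notMem (by simpa using h)⟩
      rintro h ⟨j, hj⟩
      rw [cellIndex_of_mem hd hj] at h
      cases h
    rw [this]
    exact (MeasurableSet.iUnion hD).compl
  | some j =>
    have : cellIndex D ⁻¹' {some j} = D j := by
      ext x
      refine ⟨fun h => ?_, fun h => cellIndex_of_mem hd h⟩
      by_cases hx : ∃ i, x ∈ D i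
      · obtain ⟨i, hi⟩ := hx
        rw [mem_preimage, cellIndex_of_mem hd hi, mem_singleton_iff, Option.some_inj] at h
        exact h ▸ hi
      · rw [mem_preimage, cellIndex_of_forall_notMem (by simpa using hx)] at h
        cases h
    rw [this]
    exact hD j

theorem lintegral_comp_cellIndex (μ : Measure X) (hD : ∀ j, MeasurableSet (D j))
    (hd : Pairwise (Function.onFun Disjoint D)) {F : Option J → ℝ≥0∞} (h0 : F none = 0) :
    ∫⁻ x, F (cellIndex D x) ∂μ = ∑' j, F (some j) * μ (D j) := by
  simp_rw [comp_cellIndex_eq_tsum hd h0]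
  rw [lintegral_tsum fun j => (measurable_const.indicator (hD j)).aemeasurable]
  simp [lintegral_indicator_const (hD _)]

end Cells

/-! ### Disjoint families of small sets and of large sets -/

section Measure

variable {X : Type*} [MeasurableSpace X] {μ : Measure X}

theorem IsAtomless.exists_lt_top (hμ : IsAtomless μ) {A : Set X} (hA : MeasurableSet A)
    (h0 : 0 < μ A) : ∃ B ⊆ A, MeasurableSet B ∧ 0 < μ B ∧ μ B < ∞ := by
  obtain ⟨B, hB, hm, h1, h2⟩ := hμ A hA h0
  exact ⟨B, hB, hm, h1, h2.trans_le le_top⟩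

theorem IsAtomless.exists_le_half (hμ : IsAtomless μ) {A : Set X} (hA : MeasurableSet A)
    (h0 : 0 < μ A) (hfin : μ A < ∞) :
    ∃ B ⊆ A, MeasurableSet B ∧ 0 < μ B ∧ μ B ≤ μ A / 2 := by
  obtain ⟨B, hB, hm, h1, h2⟩ := hμ A hA h0
  rcases le_or_gt (μ B) (μ A / 2) with h | h
  · exact ⟨B, hB, hm, h1, h⟩
  · have hd : μ (A \ B) = μ A - μ B :=
      measure_sdiff hB hm.nullMeasurableSet (h2.trans_le le_top).ne
    refine ⟨A \ B, sdiff_subset, hA.diff hm, ?_, ?_⟩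
    · rw [hd]
      exact tsub_pos_of_lt h2
    · rw [hd]
      refine (tsub_le_tsub_left h.le _).trans ?_
      rw [ENNReal.sub_half hfin.ne]

theorem IsAtomless.exists_le (hμ : IsAtomless μ) {A : Set X} (hA : MeasurableSet A)
    (h0 : 0 < μ A) {ε : ℝ≥0∞} (hε : 0 < ε) :
    ∃ B ⊆ A, MeasurableSet B ∧ 0 < μ B ∧ μ B < ∞ ∧ μ B ≤ ε := by
  obtain ⟨B₀, hB₀, hm₀, h₀, hf⟩ := hμ.exists_lt_top hA h0
  have key : ∀ n : ℕ, ∃ B ⊆ A, MeasurableSet B ∧ 0 < μ B ∧ μ B ≤ μ B₀ * (2⁻¹ : ℝ≥0∞) ^ n := by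
    intro n
    induction n with
    | zero => exact ⟨B₀, hB₀, hm₀, h₀, by simp⟩
    | succ n ih =>
      obtain ⟨B, hB, hm, h1, h2⟩ := ih
      have hBf : μ B < ∞ := h2.trans_lt (ENNReal.mul_lt_top hf (by simp))
      obtain ⟨C, hC, hCm, hC1, hC2⟩ := hμ.exists_le_half hm h1 hBf
      refine ⟨C, hC.trans hB, hCm, hC1, hC2.trans ?_⟩
      rw [pow_succ, ← mul_assoc, ENNReal.div_eq_inv_mul, mul_comm]
      gcongr
  have hlim : Filter.Tendsto (fun n : ℕ => μ B₀ * (2⁻¹ : ℝ≥0∞) ^ n) Filter.atTop (nhds 0) := by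
    have := ENNReal.Tendsto.const_mul (a := μ B₀)
      (ENNReal.tendsto_pow_atTop_nhds_zero_of_lt_one (r := 2⁻¹) (by simp)) (Or.inr hf.ne)
    simpa using this
  obtain ⟨n, hn⟩ := (hlim.eventually_lt_const (lt_min hε (by simp : (0 : ℝ≥0∞) < ∞))).exists
  obtain ⟨B, hB, hm, h1, h2⟩ := key n
  have h3 := h2.trans_lt hn
  exact ⟨B, hB, hm, h1, h3.trans_le (min_le_right _ _), (h3.trans_le (min_le_left _ _)).le⟩

/-- In an atomless measure, every sequence of sets of positive measure has a disjoint refinement by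
sets of small positive measure: shrink the sets so fast that each of them keeps positive measure
after the removal of all the later ones. -/
theorem IsAtomless.exists_disjoint_le (hμ : IsAtomless μ) {V : ℕ → Set X}
    (hV : ∀ n, MeasurableSet (V n)) (hV0 : ∀ n, 0 < μ (V n)) {ε : ℕ → ℝ≥0∞} (hε : ∀ n, 0 < ε n) :
    ∃ D : ℕ → Set X, (∀ n, MeasurableSet (D n)) ∧ Pairwise (Function.onFun Disjoint D) ∧
      ∀ n, D n ⊆ V n ∧ 0 < μ (D n) ∧ μ (D n) ≤ ε n ∧ μ (D n) < ∞ := by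
  choose! B hBV hBm hB0 hBf hBe using
    fun (n : ℕ) (δ : ℝ≥0∞) (hδ : 0 < δ) => hμ.exists_le (hV n) (hV0 n) (ε := δ) hδ
  -- the bound imposed on the measure of the `n`-th set
  let δ : ℕ → ℝ≥0∞ := fun n =>
    Nat.rec (ε 0) (fun k d => min (ε (k + 1)) (μ (B k d) / 4)) n
  have hδs : ∀ n, δ (n + 1) = min (ε (n + 1)) (μ (B n (δ n)) / 4) := fun n => rfl
  have hδ0 : ∀ n, 0 < δ n := by
    intro n
    induction n with
    | zero => exact hε 0
    | succ n ih =>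
      rw [hδs]
      exact lt_min (hε _) (ENNReal.div_pos (hB0 n _ ih).ne' (by simp))
  have hδε : ∀ n, δ n ≤ ε n := by
    intro n
    cases n with
    | zero => exact le_rfl
    | succ n => rw [hδs]; exact min_le_left _ _
  set C : ℕ → Set X := fun n => B n (δ n) with hC
  have hstep : ∀ n, μ (C (n + 1)) ≤ μ (C n) * 4⁻¹ := fun n =>
    (hBe (n + 1) _ (hδ0 (n + 1))).trans ((hδs n).le.trans (min_le_right _ _))
  have hgeo : ∀ n k, μ (C (n + 1 + k)) ≤ μ (C n) * (4⁻¹ * (4⁻¹ : ℝ≥0∞) ^ k) := by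
    intro n k
    induction k with
    | zero => simpa using hstep n
    | succ k ih =>
      refine (hstep (n + 1 + k)).trans ?_
      calc μ (C (n + 1 + k)) * 4⁻¹ ≤ (μ (C n) * (4⁻¹ * (4⁻¹ : ℝ≥0∞) ^ k)) * 4⁻¹ := by gcongr
        _ = _ := by ring
  have htail : ∀ n, μ (⋃ k, C (n + 1 + k)) < μ (C n) := by
    intro n
    have h0 := hB0 n _ (hδ0 n)
    have hf := hBf n _ (hδ0 n)
    have hs : (4⁻¹ : ℝ≥0∞) * ∑' k : ℕ, (4⁻¹ : ℝ≥0∞) ^ k ≤ 2⁻¹ := by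
      rw [ENNReal.tsum_geometric]
      have h1 : (2⁻¹ : ℝ≥0∞) ≤ 1 - 4⁻¹ := by
        refine ENNReal.le_sub_of_add_le_right (by simp) ?_
        rw [← ENNReal.inv_two_add_inv_two]
        gcongr
        norm_num
      calc (4⁻¹ : ℝ≥0∞) * (1 - 4⁻¹)⁻¹ ≤ 4⁻¹ * (2⁻¹)⁻¹ := by gcongr
        _ = 2⁻¹ := by
          rw [inv_inv, show (4 : ℝ≥0∞) = 2 * 2 by norm_num,
            ENNReal.mul_inv (by simp) (by simp), mul_assoc,
            ENNReal.inv_mul_cancel (by simp) (by simp), mul_one]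
    calc μ (⋃ k, C (n + 1 + k)) ≤ ∑' k, μ (C (n + 1 + k)) := measure_iUnion_le _
      _ ≤ ∑' k, μ (C n) * (4⁻¹ * (4⁻¹ : ℝ≥0∞) ^ k) := ENNReal.tsum_le_tsum (hgeo n)
      _ = μ (C n) * (4⁻¹ * ∑' k, (4⁻¹ : ℝ≥0∞) ^ k) := by
        rw [ENNReal.tsum_mul_left, ENNReal.tsum_mul_left]
      _ ≤ μ (C n) * 2⁻¹ := by gcongr
      _ < μ (C n) := ENNReal.half_lt_self h0.ne' hf.ne
  have hCm : ∀ n, MeasurableSet (C n) := fun n => hBm n _ (hδ0 n)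
  refine ⟨fun n => C n \ ⋃ k, C (n + 1 + k), fun n => (hCm n).diff (.iUnion fun k => hCm _), ?_,
    fun n => ⟨sdiff_subset.trans (hBV n _ (hδ0 n)), ?_, ?_, ?_⟩⟩
  · refine (pairwise_disjoint_on _).2 fun m n hmn => Set.disjoint_left.2 fun x hx hx' => hx.2 ?_
    refine mem_iUnion.2 ⟨n - (m + 1), ?_⟩
    rw [show m + 1 + (n - (m + 1)) = n by omega]
    exact hx'.1
  · exact (tsub_pos_of_lt (htail n)).trans_le le_measure_sdiff
  · exact (measure_mono sdiff_subset).trans ((hBe n _ (hδ0 n)).trans (hδε n))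
  · exact (measure_mono sdiff_subset).trans_lt (hBf n _ (hδ0 n))

/-- An atomless measure is semifinite, hence sets of infinite measure have subsets of arbitrarily
large finite measure. -/
theorem IsAtomless.exists_lt_measure_lt_top (hμ : IsAtomless μ) {A : Set X} (hA : MeasurableSet A)
    (h : μ A = ∞) {M : ℝ≥0∞} (hM : M < ∞) : ∃ B ⊆ A, MeasurableSet B ∧ M < μ B ∧ μ B < ∞ := by
  by_contra! hcon
  have hle : ∀ B ⊆ A, MeasurableSet B → μ B < ∞ → μ B ≤ M := by
    intro B hB hm hf
    by_contra! hlt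
    exact absurd (hcon B hB hm hlt) (not_le.2 hf)
  -- a set of finite measure whose measure is the supremum of the finite measures of subsets of `A`
  set s : ℝ≥0∞ := ⨆ B : {B : Set X // B ⊆ A ∧ MeasurableSet B ∧ μ B < ∞}, μ B.1 with hs
  have hsM : s ≤ M := iSup_le fun B => hle _ B.2.1 B.2.2.1 B.2.2.2
  have : Nonempty {B : Set X // B ⊆ A ∧ MeasurableSet B ∧ μ B < ∞} :=
    ⟨∅, empty_subset _, .empty, by simp⟩
  obtain ⟨u, -, hu, hulim⟩ := exists_seq_tendsto_sSup
    (range_nonempty fun B : {B : Set X // B ⊆ A ∧ MeasurableSet B ∧ μ B < ∞} => μ B.1)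
    (OrderTop.bddAbove _)
  choose C hC using hulim
  set T : ℕ → Set X := fun n => ⋃ k ∈ Finset.range (n + 1), (C k).1 with hT
  have hTm : ∀ n, MeasurableSet (T n) := fun n =>
    Finset.measurableSet_biUnion _ fun k _ => (C k).2.2.1
  have hTA : ∀ n, T n ⊆ A := fun n => iUnion₂_subset fun k _ => (C k).2.1
  have hTf : ∀ n, μ (T n) < ∞ := fun n =>
    (measure_biUnion_finset_le _ _).trans_lt (ENNReal.sum_lt_top.2 fun k _ => (C k).2.2.2)
  have hTmono : Monotone T := by
    intro m n hmn x hx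
    simp only [hT, mem_iUnion, Finset.mem_range] at hx ⊢
    obtain ⟨k, hk, h⟩ := hx
    exact ⟨k, by omega, h⟩
  have hUle : μ (⋃ n, T n) ≤ M := by
    rw [hTmono.measure_iUnion]
    exact iSup_le fun n => hle _ (hTA n) (hTm n) (hTf n)
  have hsU : s ≤ μ (⋃ n, T n) := by
    refine le_of_tendsto' hu fun n => ?_
    rw [← hC n]
    refine measure_mono ((?_ : (C n).1 ⊆ T n).trans (subset_iUnion T n))
    exact subset_biUnion_of_mem (u := fun k => (C k).1) (Finset.mem_coe.2 (by simp))
  have hUf : μ (⋃ n, T n) < ∞ := hUle.trans_lt hM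
  have hUm : MeasurableSet (⋃ n, T n) := .iUnion hTm
  have hinf : μ (A \ ⋃ n, T n) = ∞ := by
    rw [measure_sdiff (iUnion_subset hTA) hUm.nullMeasurableSet hUf.ne, h]
    exact ENNReal.top_sub hUf.ne
  obtain ⟨E, hE, hEm, hE0, hEf⟩ := hμ.exists_lt_top (hA.diff hUm) (by rw [hinf]; simp)
  have hdisj : Disjoint (⋃ n, T n) E := Set.disjoint_left.2 fun x hx hx' => (hE hx').2 hx
  have h1 : μ ((⋃ n, T n) ∪ E) = μ (⋃ n, T n) + μ E := measure_union hdisj hEm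
  have h2 : μ ((⋃ n, T n) ∪ E) ≤ s := by
    refine le_iSup (fun B : {B : Set X // B ⊆ A ∧ MeasurableSet B ∧ μ B < ∞} => μ B.1)
      ⟨_, union_subset (iUnion_subset hTA) (hE.trans sdiff_subset), hUm.union hEm, ?_⟩
    rw [h1]
    exact ENNReal.add_lt_top.2 ⟨hUf, hEf⟩
  have h3 := (h1 ▸ h2).trans hsU
  exact absurd h3 (not_le.2 (ENNReal.lt_add_right hUf.ne hE0.ne'))

/-- If sets of infinite measure have subsets of arbitrarily large finite measure, then a set of
infinite measure contains a disjoint sequence of sets of prescribed large finite measure. -/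
theorem exists_disjoint_ge
    (hμ : ∀ A, MeasurableSet A → μ A = ∞ → ∀ M < ∞, ∃ B ⊆ A, MeasurableSet B ∧ M < μ B ∧ μ B < ∞)
    {A : Set X} (hA : MeasurableSet A) (hinf : μ A = ∞) {M : ℕ → ℝ≥0∞} (hM : ∀ n, M n < ∞) :
    ∃ D : ℕ → Set X, (∀ n, MeasurableSet (D n)) ∧ Pairwise (Function.onFun Disjoint D) ∧
      ∀ n, D n ⊆ A ∧ M n < μ (D n) ∧ μ (D n) < ∞ := by
  choose! B hBA hBm hBM hBf using hμ
  -- the union of the sets chosen so far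
  let R : ℕ → Set X := fun n => Nat.rec ∅ (fun k r => r ∪ B (A \ r) (M k)) n
  have hR : ∀ n, R (n + 1) = R n ∪ B (A \ R n) (M n) := fun n => rfl
  have hdiff : ∀ r, MeasurableSet r → μ r < ∞ → MeasurableSet (A \ r) ∧ μ (A \ r) = ∞ := by
    intro r hr hrf
    refine ⟨hA.diff hr, top_le_iff.1 ?_⟩
    rw [← ENNReal.top_sub hrf.ne, ← hinf]
    exact le_measure_sdiff
  have hRp : ∀ n, MeasurableSet (R n) ∧ μ (R n) < ∞ := by
    intro n
    induction n with
    | zero => exact ⟨.empty, by simp [R]⟩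
    | succ n ih =>
      obtain ⟨h1, h2⟩ := hdiff _ ih.1 ih.2
      rw [hR]
      exact ⟨ih.1.union (hBm _ h1 h2 _ (hM n)), (measure_union_le _ _).trans_lt
        (ENNReal.add_lt_top.2 ⟨ih.2, hBf _ h1 h2 _ (hM n)⟩)⟩
  have hRmono : Monotone R := monotone_nat_of_le_succ fun n => by rw [hR]; exact subset_union_left
  have hsub : ∀ n, B (A \ R n) (M n) ⊆ A \ R n := fun n =>
    hBA _ (hdiff _ (hRp n).1 (hRp n).2).1 (hdiff _ (hRp n).1 (hRp n).2).2 _ (hM n)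
  refine ⟨fun n => B (A \ R n) (M n), fun n => ?_, ?_, fun n => ⟨?_, ?_, ?_⟩⟩
  · exact hBm _ (hdiff _ (hRp n).1 (hRp n).2).1 (hdiff _ (hRp n).1 (hRp n).2).2 _ (hM n)
  · refine (pairwise_disjoint_on _).2 fun m n hmn => Set.disjoint_left.2 fun x hx hx' => ?_
    refine (hsub n hx').2 (hRmono (Nat.succ_le_of_lt hmn) ?_)
    rw [Nat.succ_eq_add_one, hR]
    exact Or.inr hx
  · exact (hsub n).trans sdiff_subset
  · exact hBM _ (hdiff _ (hRp n).1 (hRp n).2).1 (hdiff _ (hRp n).1 (hRp n).2).2 _ (hM n)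
  · exact hBf _ (hdiff _ (hRp n).1 (hRp n).2).1 (hdiff _ (hRp n).1 (hRp n).2).2 _ (hM n)

end Measure

/-! ### The sequence space spanned by disjoint blocks -/

section Blocks

variable {X : Type*} [MeasurableSpace X] {𝕜 : Type*} [RCLike 𝕜] {p : ℝ≥0∞} {μ : Measure X}
  {D : ℕ × ℕ → Set X}

/-- A doubly indexed disjoint family of measurable sets of positive finite measure. The cells
`D (k, i)`, `i ∈ ℕ`, carry the `k`-th block function. -/
structure IsCellFamily (μ : Measure X) (D : ℕ × ℕ → Set X) : Prop where
  measurableSet : ∀ j, MeasurableSet (D j)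
  disjoint : Pairwise (Function.onFun Disjoint D)
  pos : ∀ j, 0 < μ (D j)
  lt_top : ∀ j, μ (D j) < ∞

/-- The value on the cell `D (k, i)` of the `k`-th block function, chosen so that this cell
contributes `2⁻¹ ^ (i + 1)` to the integral of the `p`-th power. -/
noncomputable def weight (p : ℝ≥0∞) (μ : Measure X) (D : ℕ × ℕ → Set X) (j : ℕ × ℕ) : ℝ :=
  ((2⁻¹ : ℝ) ^ (j.2 + 1) / μ.real (D j)) ^ p.toReal⁻¹

/-- The linear combination of the block functions with coefficients `a`. -/
noncomputable def blockSum (p : ℝ≥0∞) (μ : Measure X) (D : ℕ × ℕ → Set X) (a : ℕ → 𝕜) (x : X) : 𝕜 :=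
  (cellIndex D x).elim 0 fun j => a j.1 * (weight p μ D j : 𝕜)

theorem IsCellFamily.real_pos (h : IsCellFamily μ D) (j : ℕ × ℕ) : 0 < μ.real (D j) :=
  ENNReal.toReal_pos (h.pos j).ne' (h.lt_top j).ne

theorem IsCellFamily.weight_pos (h : IsCellFamily μ D) (j : ℕ × ℕ) : 0 < weight p μ D j :=
  Real.rpow_pos_of_pos (div_pos (by positivity) (h.real_pos j)) _

theorem IsCellFamily.weight_rpow_mul (h : IsCellFamily μ D) (hp : 0 < p.toReal) (j : ℕ × ℕ) :
    ENNReal.ofReal (weight p μ D j) ^ p.toReal * μ (D j) = 2⁻¹ ^ (j.2 + 1) := by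
  have hm := h.real_pos j
  have hw : weight p μ D j ^ p.toReal * μ.real (D j) = (2⁻¹ : ℝ) ^ (j.2 + 1) := by
    rw [weight, ← Real.rpow_mul (by positivity), inv_mul_cancel₀ hp.ne', Real.rpow_one,
      div_mul_cancel₀ _ hm.ne']
  rw [ENNReal.ofReal_rpow_of_nonneg (h.weight_pos j).le hp.le,
    ← ENNReal.ofReal_toReal (h.lt_top j).ne, ← ENNReal.ofReal_mul (by
      have := (h.weight_pos (p := p) j).le
      positivity), ← measureReal_def, hw, ENNReal.ofReal_pow (by norm_num),
    ENNReal.ofReal_inv_of_pos (by norm_num)]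
  norm_num

theorem blockSum_of_mem (h : IsCellFamily μ D) (a : ℕ → 𝕜) {x : X} {j : ℕ × ℕ} (hx : x ∈ D j) :
    blockSum p μ D a x = a j.1 * (weight p μ D j : 𝕜) := by
  rw [blockSum, cellIndex_of_mem h.disjoint hx, Option.elim_some]

theorem norm_blockSum_of_mem (h : IsCellFamily μ D) (a : ℕ → 𝕜) {x : X} {j : ℕ × ℕ}
    (hx : x ∈ D j) : ‖blockSum p μ D a x‖ = ‖a j.1‖ * weight p μ D j := by
  rw [blockSum_of_mem h a hx, norm_mul, RCLike.norm_ofReal, abs_of_pos (h.weight_pos j)]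

theorem measurable_blockSum (h : IsCellFamily μ D) (a : ℕ → 𝕜) :
    Measurable (blockSum p μ D a) :=
  measurable_comp_cellIndex h.measurableSet h.disjoint
    fun o : Option (ℕ × ℕ) => o.elim 0 fun j => a j.1 * (weight p μ D j : 𝕜)

theorem lintegral_blockSum (h : IsCellFamily μ D) (hp : 0 < p.toReal) (a : ℕ → 𝕜) :
    ∫⁻ x, ‖blockSum p μ D a x‖ₑ ^ p.toReal ∂μ = ∑' k, ‖a k‖ₑ ^ p.toReal := by
  have h1 := lintegral_comp_cellIndex μ h.measurableSet h.disjoint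
    (F := fun o : Option (ℕ × ℕ) =>
      ‖o.elim (0 : 𝕜) fun j => a j.1 * (weight p μ D j : 𝕜)‖ₑ ^ p.toReal)
    (by simp [hp])
  refine h1.trans ?_
  have h2 : ∀ j : ℕ × ℕ, ‖a j.1 * (weight p μ D j : 𝕜)‖ₑ ^ p.toReal * μ (D j)
      = ‖a j.1‖ₑ ^ p.toReal * 2⁻¹ ^ (j.2 + 1) := by
    intro j
    have h3 : ‖(weight p μ D j : 𝕜)‖ₑ = ENNReal.ofReal (weight p μ D j) := by
      rw [← ofReal_norm, RCLike.norm_ofReal, abs_of_pos (h.weight_pos j)]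
    rw [enorm_mul, ENNReal.mul_rpow_of_nonneg _ _ hp.le, mul_assoc, h3, h.weight_rpow_mul hp]
  simp only [Option.elim_some, h2]
  rw [ENNReal.tsum_prod (f := fun k i => ‖a k‖ₑ ^ p.toReal * 2⁻¹ ^ (i + 1))]
  refine tsum_congr fun k => ?_
  rw [ENNReal.tsum_mul_left, ENNReal.tsum_geometric_add_one, ENNReal.one_sub_inv_two, inv_inv,
    ENNReal.inv_mul_cancel (by simp) (by simp), mul_one]

theorem tsum_enorm_rpow_ne_top_iff (hp : 0 < p.toReal) (a : ℕ → 𝕜) :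
    ∑' k, ‖a k‖ₑ ^ p.toReal ≠ ∞ ↔ Memℓp a p := by
  have h1 : ∀ k, ‖a k‖ₑ ^ p.toReal = ENNReal.ofReal (‖a k‖ ^ p.toReal) := fun k => by
    rw [← ofReal_norm, ENNReal.ofReal_rpow_of_nonneg (norm_nonneg _) hp.le]
  rw [memℓp_gen_iff hp]
  simp_rw [h1]
  refine ⟨fun h => ?_, fun h => h.tsum_ofReal_ne_top⟩
  have := ENNReal.summable_toReal h
  refine this.congr fun k => ?_
  rw [ENNReal.toReal_ofReal (by positivity)]

theorem tsum_enorm_rpow_eq (hp : 0 < p.toReal) (a : lp (fun _ : ℕ => 𝕜) p) :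
    ∑' k, ‖a k‖ₑ ^ p.toReal = ENNReal.ofReal ‖a‖ ^ p.toReal := by
  have h1 : ∀ k, ‖a k‖ₑ ^ p.toReal = ENNReal.ofReal (‖a k‖ ^ p.toReal) := fun k => by
    rw [← ofReal_norm, ENNReal.ofReal_rpow_of_nonneg (norm_nonneg _) hp.le]
  have h2 : (0 : ℝ) ≤ ‖a‖ := lp.norm_nonneg' a
  rw [tsum_congr h1, ENNReal.ofReal_rpow_of_nonneg h2 hp.le, lp.norm_rpow_eq_tsum hp,
    ENNReal.ofReal_tsum_of_nonneg (fun k => by positivity)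
      ((memℓp_gen_iff hp).1 (lp.memℓp a))]

theorem eLpNorm_blockSum (h : IsCellFamily μ D) (hp : 0 < p.toReal)
    (a : lp (fun _ : ℕ => 𝕜) p) : eLpNorm (blockSum p μ D a) p μ = ENNReal.ofReal ‖a‖ := by
  obtain ⟨h0, h1⟩ := ENNReal.toReal_pos_iff.1 hp
  rw [eLpNorm_eq_lintegral_rpow_enorm_toReal h0.ne' h1.ne, lintegral_blockSum h hp,
    tsum_enorm_rpow_eq hp, ← ENNReal.rpow_mul, mul_one_div_cancel hp.ne', ENNReal.rpow_one]

theorem memLp_blockSum (h : IsCellFamily μ D) (hp : 0 < p.toReal)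
    (a : lp (fun _ : ℕ => 𝕜) p) : MemLp (blockSum p μ D a) p μ :=
  ⟨(measurable_blockSum h _).aestronglyMeasurable, by
    rw [eLpNorm_blockSum h hp]; exact ENNReal.ofReal_lt_top⟩

/-- The isometric embedding of `ℓ_p` into `L^p` that maps the unit vectors to the block
functions. -/
noncomputable def blockEmbedding (h : IsCellFamily μ D) (hp : 0 < p.toReal) :
    lp (fun _ : ℕ => 𝕜) p →ₗ[𝕜] Lp 𝕜 p μ where
  toFun a := (memLp_blockSum h hp a).toLp
  map_add' a b := by
    rw [← MemLp.toLp_add]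
    refine MemLp.toLp_congr _ _ (Filter.Eventually.of_forall fun x => ?_)
    cases hx : cellIndex D x <;> simp [blockSum, hx, add_mul]
  map_smul' c a := by
    rw [RingHom.id_apply, ← MemLp.toLp_const_smul]
    refine MemLp.toLp_congr _ _ (Filter.Eventually.of_forall fun x => ?_)
    cases hx : cellIndex D x <;> simp [blockSum, hx, mul_assoc]

theorem coeFn_blockEmbedding (h : IsCellFamily μ D) (hp : 0 < p.toReal)
    (a : lp (fun _ : ℕ => 𝕜) p) : blockEmbedding h hp a =ᵐ[μ] blockSum p μ D a :=
  MemLp.coeFn_toLp (memLp_blockSum h hp a)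

theorem norm_blockEmbedding (h : IsCellFamily μ D) (hp : 0 < p.toReal)
    (a : lp (fun _ : ℕ => 𝕜) p) : ‖blockEmbedding h hp a‖ = ‖a‖ := by
  rw [blockEmbedding, LinearMap.coe_mk, AddHom.coe_mk, Lp.norm_toLp, eLpNorm_blockSum h hp]
  exact ENNReal.toReal_ofReal (lp.norm_nonneg' a)

theorem blockEmbedding_injective (h : IsCellFamily μ D) (hp : 0 < p.toReal) :
    Function.Injective (blockEmbedding (𝕜 := 𝕜) h hp) := by
  refine (injective_iff_map_eq_zero _).2 fun a ha => lp.norm_eq_zero_iff.1 ?_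
  rw [← norm_blockEmbedding h hp, ha, Lp.norm_zero]

theorem isIsometricToSeqSpace_range (h : IsCellFamily μ D) (hp : 0 < p.toReal) :
    IsIsometricToSeqSpace (LinearMap.range (blockEmbedding (𝕜 := 𝕜) h hp)) :=
  ⟨LinearEquiv.ofInjective _ (blockEmbedding_injective h hp), fun a => by
    rw [LinearEquiv.ofInjective_apply, norm_blockEmbedding]⟩

/-- The `k`-th coefficient of the projection onto the span of the block functions: the mean of a
function over the cell `D (k, 0)`, divided by the value of the block function on it. -/
noncomputable def blockCoeff (p : ℝ≥0∞) (μ : Measure X) (D : ℕ × ℕ → Set X) (g : X → 𝕜)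
    (k : ℕ) : 𝕜 :=
  ((weight p μ D (k, 0) * μ.real (D (k, 0)) : ℝ) : 𝕜)⁻¹ * ∫ x in D (k, 0), g x ∂μ

/-- Since the cell `D (k, 0)` carries half of the `p`-th power of the norm of the block function,
Hölder's inequality bounds the coefficient. -/
theorem enorm_blockCoeff_rpow_le (h : IsCellFamily μ D) (hp1 : 1 ≤ p) (hp : p < ∞) {g : X → 𝕜}
    (hg : MemLp g p μ) (k : ℕ) :
    ‖blockCoeff p μ D g k‖ₑ ^ p.toReal
      ≤ 2 * ∫⁻ x in D (k, 0), ‖g x‖ₑ ^ p.toReal ∂μ := by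
  have hp0 : p ≠ 0 := (zero_lt_one.trans_le hp1).ne'
  have hpr : 0 < p.toReal := ENNReal.toReal_pos hp0 hp.ne
  have hm := h.real_pos (k, 0)
  have hw := h.weight_pos (p := p) (k, 0)
  set m := μ (D (k, 0)) with hmdef
  set I := ∫⁻ x in D (k, 0), ‖g x‖ₑ ^ p.toReal ∂μ with hI
  have hm0 : m ≠ 0 := (h.pos _).ne'
  have hmt : m ≠ ∞ := (h.lt_top _).ne
  have h1 : ‖blockCoeff p μ D g k‖ₑ * (ENNReal.ofReal (weight p μ D (k, 0)) * m)
      = ‖∫ x in D (k, 0), g x ∂μ‖ₑ := by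
    have h2 : ENNReal.ofReal (weight p μ D (k, 0)) * m
        = ‖((weight p μ D (k, 0) * μ.real (D (k, 0)) : ℝ) : 𝕜)‖ₑ := by
      rw [← ofReal_norm, RCLike.norm_ofReal, abs_of_pos (mul_pos hw hm),
        ENNReal.ofReal_mul hw.le, measureReal_def, ENNReal.ofReal_toReal hmt]
    rw [h2, ← enorm_mul, blockCoeff, mul_right_comm, inv_mul_cancel₀, one_mul]
    exact RCLike.ofReal_ne_zero.2 (mul_pos hw hm).ne'
  have h3 : ‖∫ x in D (k, 0), g x ∂μ‖ₑ ≤ I ^ (1 / p.toReal) * m ^ (1 - 1 / p.toReal) := by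
    refine (enorm_integral_le_lintegral_enorm _).trans ?_
    have := eLpNorm_le_eLpNorm_mul_rpow_measure_univ hp1
      (hg.restrict (D (k, 0))).aestronglyMeasurable
    rw [eLpNorm_one_eq_lintegral_enorm, eLpNorm_eq_lintegral_rpow_enorm_toReal hp0 hp.ne,
      Measure.restrict_apply_univ] at this
    simpa using this
  have h4 := ENNReal.rpow_le_rpow (h1.le.trans h3) hpr.le
  rw [ENNReal.mul_rpow_of_nonneg _ _ hpr.le, ENNReal.mul_rpow_of_nonneg _ _ hpr.le,
    ENNReal.mul_rpow_of_nonneg _ _ hpr.le, ← ENNReal.rpow_mul, ← ENNReal.rpow_mul,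
    one_div_mul_cancel hpr.ne', ENNReal.rpow_one, sub_mul, one_div_mul_cancel hpr.ne', one_mul]
    at h4
  have h5 : m ^ p.toReal = m * m ^ (p.toReal - 1) := by
    rw [← add_sub_cancel 1 p.toReal, ENNReal.rpow_add _ _ hm0 hmt, ENNReal.rpow_one,
      add_sub_cancel]
  have h6 := h.weight_rpow_mul hpr (k, 0)
  rw [h5, ← mul_assoc (ENNReal.ofReal _ ^ _), h6, ← mul_assoc] at h4
  have h7 : m ^ (p.toReal - 1) ≠ 0 := (ENNReal.rpow_pos (h.pos _) hmt).ne'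
  have h8 : m ^ (p.toReal - 1) ≠ ∞ := by
    refine ENNReal.rpow_ne_top_of_nonneg ?_ hmt
    have := ENNReal.toReal_mono hp.ne hp1
    simpa using this
  have h9 := (ENNReal.mul_le_mul_iff_left h7 h8).1 h4
  simp only [zero_add, pow_one] at h9
  calc ‖blockCoeff p μ D g k‖ₑ ^ p.toReal
      = 2 * (‖blockCoeff p μ D g k‖ₑ ^ p.toReal * 2⁻¹) := by
        rw [mul_left_comm, ENNReal.mul_inv_cancel (by simp) (by simp), mul_one]
    _ ≤ 2 * I := by gcongr

theorem tsum_enorm_blockCoeff_rpow_le (h : IsCellFamily μ D) (hp1 : 1 ≤ p) (hp : p < ∞) {g : X → 𝕜}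
    (hg : MemLp g p μ) :
    ∑' k, ‖blockCoeff p μ D g k‖ₑ ^ p.toReal ≤ 2 * ∫⁻ x, ‖g x‖ₑ ^ p.toReal ∂μ := by
  have hd : Pairwise (Function.onFun Disjoint fun k => D (k, 0)) := fun i j hij =>
    h.disjoint fun e => hij (congrArg Prod.fst e)
  calc ∑' k, ‖blockCoeff p μ D g k‖ₑ ^ p.toReal
      ≤ ∑' k, 2 * ∫⁻ x in D (k, 0), ‖g x‖ₑ ^ p.toReal ∂μ :=
        ENNReal.tsum_le_tsum fun k => enorm_blockCoeff_rpow_le h hp1 hp hg k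
    _ = 2 * ∫⁻ x in ⋃ k, D (k, 0), ‖g x‖ₑ ^ p.toReal ∂μ := by
        rw [ENNReal.tsum_mul_left, lintegral_iUnion (fun k => h.measurableSet _) hd]
    _ ≤ 2 * ∫⁻ x, ‖g x‖ₑ ^ p.toReal ∂μ := by
        gcongr
        exact Measure.restrict_le_self

theorem blockCoeff_blockSum (h : IsCellFamily μ D) (a : ℕ → 𝕜) {g : X → 𝕜}
    (hg : g =ᵐ[μ] blockSum p μ D a) (k : ℕ) : blockCoeff p μ D g k = a k := by
  have hm := h.real_pos (k, 0)
  have hw := h.weight_pos (p := p) (k, 0)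
  have h1 : ∫ x in D (k, 0), g x ∂μ
      = ∫ _x in D (k, 0), a k * (weight p μ D (k, 0) : 𝕜) ∂μ := by
    refine setIntegral_congr_ae (h.measurableSet _) ?_
    filter_upwards [hg] with x hx hxD
    rw [hx, blockSum_of_mem h a hxD]
  rw [blockCoeff, h1, setIntegral_const, RCLike.real_smul_eq_coe_mul, RCLike.ofReal_mul]
  have hm' : (μ.real (D (k, 0)) : 𝕜) ≠ 0 := RCLike.ofReal_ne_zero.2 hm.ne'
  have hw' : (weight p μ D (k, 0) : 𝕜) ≠ 0 := RCLike.ofReal_ne_zero.2 hw.ne'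
  field_simp

theorem closedComplemented_range [Fact (1 ≤ p)] (h : IsCellFamily μ D) (hpr : 0 < p.toReal) :
    (LinearMap.range (blockEmbedding (𝕜 := 𝕜) h hpr)).ClosedComplemented := by
  have hp1 : 1 ≤ p := Fact.out
  obtain ⟨h0, hp⟩ := ENNReal.toReal_pos_iff.1 hpr
  have hlp : ∀ g : Lp 𝕜 p μ, ∫⁻ x, ‖g x‖ₑ ^ p.toReal ∂μ = ENNReal.ofReal ‖g‖ ^ p.toReal := by
    intro g
    rw [Lp.norm_def, ENNReal.ofReal_toReal (Lp.eLpNorm_ne_top g),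
      eLpNorm_eq_lintegral_rpow_enorm_toReal h0.ne' hp.ne, ← ENNReal.rpow_mul,
      one_div_mul_cancel hpr.ne', ENNReal.rpow_one]
  have hle : ∀ g : Lp 𝕜 p μ, ∑' k, ‖blockCoeff p μ D g k‖ₑ ^ p.toReal
      ≤ 2 * ENNReal.ofReal ‖g‖ ^ p.toReal := fun g =>
    hlp g ▸ tsum_enorm_blockCoeff_rpow_le h hp1 hp (Lp.memLp g)
  have hmem : ∀ g : Lp 𝕜 p μ, Memℓp (blockCoeff p μ D g) p := fun g =>
    (tsum_enorm_rpow_ne_top_iff hpr _).1 ((hle g).trans_lt (ENNReal.mul_lt_top (by simp)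
      (ENNReal.rpow_lt_top_of_nonneg hpr.le (by simp)))).ne
  have hint : ∀ (g : Lp 𝕜 p μ) k, IntegrableOn g (D (k, 0)) μ := fun g k =>
    have : IsFiniteMeasure (μ.restrict (D (k, 0))) :=
      ⟨by rw [Measure.restrict_apply_univ]; exact h.lt_top _⟩
    ((Lp.memLp g).restrict _).integrable hp1
  let φ : Lp 𝕜 p μ →ₗ[𝕜] lp (fun _ : ℕ => 𝕜) p :=
    { toFun := fun g => ⟨blockCoeff p μ D g, hmem g⟩
      map_add' := fun f g => by
        ext k
        have : ∫ x in D (k, 0), (f + g : Lp 𝕜 p μ) x ∂μ = ∫ x in D (k, 0), (f x + g x) ∂μ :=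
          integral_congr_ae (ae_restrict_of_ae (Lp.coeFn_add f g))
        change blockCoeff p μ D (f + g : Lp 𝕜 p μ) k = blockCoeff p μ D f k + blockCoeff p μ D g k
        rw [blockCoeff, this, integral_add (hint f k) (hint g k), mul_add]
        rfl
      map_smul' := fun c f => by
        ext k
        have : ∫ x in D (k, 0), (c • f : Lp 𝕜 p μ) x ∂μ = ∫ x in D (k, 0), c • f x ∂μ :=
          integral_congr_ae (ae_restrict_of_ae (Lp.coeFn_smul c f))
        change blockCoeff p μ D (c • f : Lp 𝕜 p μ) k = c * blockCoeff p μ D f k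
        rw [blockCoeff, this, integral_smul, smul_eq_mul, mul_left_comm]
        rfl }
  have hφ : ∀ g, ‖φ g‖ ≤ (2 : ℝ) ^ p.toReal⁻¹ * ‖g‖ := by
    intro g
    have h1 : ENNReal.ofReal ‖φ g‖ ^ p.toReal ≤ 2 * ENNReal.ofReal ‖g‖ ^ p.toReal := by
      rw [← tsum_enorm_rpow_eq hpr]
      exact hle g
    rw [← ENNReal.ofReal_ofNat 2, ENNReal.ofReal_rpow_of_nonneg (norm_nonneg _) hpr.le,
      ENNReal.ofReal_rpow_of_nonneg (norm_nonneg _) hpr.le, ← ENNReal.ofReal_mul (by norm_num),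
      ENNReal.ofReal_le_ofReal_iff (by positivity)] at h1
    rw [← Real.rpow_le_rpow_iff (norm_nonneg _) (by positivity) hpr,
      Real.mul_rpow (by positivity) (norm_nonneg _), ← Real.rpow_mul (by norm_num),
      inv_mul_cancel₀ hpr.ne', Real.rpow_one]
    exact h1
  refine ⟨((blockEmbedding h hpr).rangeRestrict ∘ₗ φ).mkContinuous ((2 : ℝ) ^ p.toReal⁻¹)
    fun g => ?_, ?_⟩
  · change ‖blockEmbedding h hpr (φ g)‖ ≤ _
    rw [norm_blockEmbedding]
    exact hφ g
  · rintro ⟨-, a, rfl⟩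
    refine Subtype.ext ?_
    change blockEmbedding h hpr (φ (blockEmbedding h hpr a)) = blockEmbedding h hpr a
    congr 1
    refine lp.ext (funext fun k => ?_)
    exact blockCoeff_blockSum h a (coeFn_blockEmbedding h hpr a) k

/-- If every nonzero combination of the block functions lies in `A`, then `A` contains `ℓ_p`
isometrically and complementably. -/
theorem containsSeqSpace_of_isCellFamily (h : IsCellFamily μ D) (hp : 0 < p.toReal)
    {A : Set (Lp 𝕜 p μ)} (hA : ∀ a : lp (fun _ : ℕ => 𝕜) p, a ≠ 0 → blockEmbedding h hp a ∈ A) :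
    ContainsSeqSpace A := by
  refine ⟨LinearMap.range (blockEmbedding h hp), ?_, isIsometricToSeqSpace_range h hp,
    fun _ => closedComplemented_range h hp⟩
  rintro - ⟨a, rfl⟩
  by_cases ha : a = 0
  · exact Or.inr (by simp [ha])
  · exact Or.inl (hA a ha)

end Blocks

/-! ### Non-integrability of block sums -/

section NonIntegrability

variable {X : Type*} [MeasurableSpace X] {𝕜 : Type*} [RCLike 𝕜] {p q : ℝ≥0∞} {μ : Measure X}
  {D : ℕ × ℕ → Set X}

/-- A Chebyshev-type criterion, also for `q = ∞`, where the exponent `1 / q.toReal` is zero. -/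
theorem not_memLp_restrict (hq : q ≠ 0) {U : Set X} {f : X → 𝕜}
    (h : ∀ M : ℝ, ∃ T ⊆ U, ∃ c : ℝ, MeasurableSet T ∧ 0 < μ T ∧ μ T < ∞ ∧ 0 ≤ c ∧
      (∀ᵐ x ∂μ, x ∈ T → c ≤ ‖f x‖) ∧ M ≤ c * μ.real T ^ (1 / q.toReal)) :
    ¬ MemLp f q (μ.restrict U) := by
  intro hf
  obtain ⟨T, hTU, c, hT, h0, hfin, hc, hcf, hM⟩ := h ((eLpNorm f q (μ.restrict U)).toReal + 1)
  have h1 : eLpNorm (fun _ => c) q (μ.restrict T) ≤ eLpNorm f q (μ.restrict U) := by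
    refine (eLpNorm_mono_ae ?_).trans (eLpNorm_mono_measure f (Measure.restrict_mono hTU le_rfl))
    refine (ae_restrict_iff' hT).2 (hcf.mono fun x hx hxT => ?_)
    rw [Real.norm_of_nonneg hc]
    exact hx hxT
  rw [eLpNorm_const _ hq (by simpa using h0.ne'), Measure.restrict_apply_univ] at h1
  have h2 := ENNReal.toReal_mono hf.2.ne h1
  rw [ENNReal.toReal_mul, ← ENNReal.toReal_rpow, ← measureReal_def, toReal_enorm,
    Real.norm_of_nonneg hc] at h2
  linarith

theorem IsCellFamily.weight_mul_rpow (h : IsCellFamily μ D) (k i : ℕ) (v : ℝ) :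
    weight p μ D (k, i) * μ.real (D (k, i)) ^ v
      = 2 ^ (-((i : ℝ) + 1) * p.toReal⁻¹) * μ.real (D (k, i)) ^ (v - p.toReal⁻¹) := by
  have hm := h.real_pos (k, i)
  have h2 : (2⁻¹ : ℝ) ^ (i + 1) = 2 ^ (-((i : ℝ) + 1)) := by
    rw [Real.rpow_neg (by norm_num), ← Nat.cast_add_one, Real.rpow_natCast, inv_pow]
  rw [weight, Real.div_rpow (by positivity) hm.le, Real.rpow_sub hm, h2,
    ← Real.rpow_mul (by norm_num)]
  ring

/-- On a small cell the weight is large. -/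
theorem IsCellFamily.le_weight_mul_rpow_of_le (h : IsCellFamily μ D) {k i : ℕ}
    (hi : μ (D (k, i)) ≤ 2⁻¹ ^ i ^ 2) {v : ℝ} (hv : v ≤ p.toReal⁻¹) :
    2 ^ ((i : ℝ) ^ 2 * (p.toReal⁻¹ - v) - ((i : ℝ) + 1) * p.toReal⁻¹)
      ≤ weight p μ D (k, i) * μ.real (D (k, i)) ^ v := by
  have hm := h.real_pos (k, i)
  have hi' : μ.real (D (k, i)) ≤ 2 ^ (-(i : ℝ) ^ 2) := by
    have := ENNReal.toReal_mono (by simp) hi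
    rw [Real.rpow_neg (by norm_num), ← Nat.cast_pow, Real.rpow_natCast, ← inv_pow]
    simpa [measureReal_def] using this
  rw [h.weight_mul_rpow, sub_eq_add_neg, add_comm, Real.rpow_add (by norm_num), neg_mul]
  refine mul_le_mul_of_nonneg_left ?_ (by positivity)
  have := Real.rpow_le_rpow_of_nonpos hm hi' (sub_nonpos.2 hv)
  rwa [← Real.rpow_mul (by norm_num), neg_mul, ← mul_neg, neg_sub] at this

theorem IsCellFamily.le_weight_mul_rpow_of_ge (h : IsCellFamily μ D) {k i : ℕ}
    (hi : 2 ^ i ^ 2 ≤ μ (D (k, i))) {v : ℝ} (hv : p.toReal⁻¹ ≤ v) :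
    2 ^ ((i : ℝ) ^ 2 * (v - p.toReal⁻¹) - ((i : ℝ) + 1) * p.toReal⁻¹)
      ≤ weight p μ D (k, i) * μ.real (D (k, i)) ^ v := by
  have hi' : 2 ^ ((i : ℝ) ^ 2) ≤ μ.real (D (k, i)) := by
    have := ENNReal.toReal_mono (h.lt_top _).ne hi
    rw [← Nat.cast_pow, Real.rpow_natCast]
    simpa [measureReal_def] using this
  rw [h.weight_mul_rpow, sub_eq_add_neg, add_comm, Real.rpow_add (by norm_num), neg_mul]
  refine mul_le_mul_of_nonneg_left ?_ (by positivity)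
  have := Real.rpow_le_rpow (by positivity) hi' (sub_nonneg.2 hv)
  rwa [← Real.rpow_mul (by norm_num)] at this

theorem tendsto_two_rpow_atTop {θ : ℝ} (hθ : 0 < θ) (u : ℝ) :
    Filter.Tendsto (fun i : ℕ => (2 : ℝ) ^ ((i : ℝ) ^ 2 * θ - ((i : ℝ) + 1) * u))
      Filter.atTop Filter.atTop := by
  refine (tendsto_rpow_atTop_of_base_gt_one 2 (by norm_num)).comp ?_
  have h1 : Filter.Tendsto (fun i : ℕ => (i : ℝ) * θ - u) Filter.atTop Filter.atTop :=
    Filter.tendsto_atTop_add_const_right _ _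
      (tendsto_natCast_atTop_atTop.atTop_mul_const hθ)
  have h2 := Filter.tendsto_atTop_add_const_right _ (-u)
    (tendsto_natCast_atTop_atTop.atTop_mul_atTop₀ h1)
  refine h2.congr fun i => ?_
  ring

theorem inv_toReal_lt_inv_toReal (hp : 0 < p.toReal) (hpq : p < q) :
    1 / q.toReal < p.toReal⁻¹ := by
  rcases eq_or_ne q ∞ with rfl | hq
  · simpa using hp
  · rw [one_div]
    exact inv_strictAnti₀ hp (ENNReal.toReal_strict_mono hq hpq)

/-- Every block has arbitrarily late, hence very small, cells in every nonempty open set. -/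
def IsFine [TopologicalSpace X] (μ : Measure X) (D : ℕ × ℕ → Set X) : Prop :=
  ∀ k, ∀ U : Set X, IsOpen U → U.Nonempty → ∀ N, ∃ i ≥ N, D (k, i) ⊆ U ∧
    μ (D (k, i)) ≤ 2⁻¹ ^ i ^ 2

/-- Every block has arbitrarily late cells of very large measure. -/
def IsCoarse (μ : Measure X) (D : ℕ × ℕ → Set X) : Prop :=
  ∀ k N, ∃ i ≥ N, 2 ^ i ^ 2 ≤ μ (D (k, i))

/-- A nonzero block sum over a fine family of cells is nowhere `L^q` for `q > p`, and so is its sum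
with a bounded function, because the values of the block sum on the small cells tend to infinity. -/
theorem isNowhereLq_of_isFine [TopologicalSpace X] (h : IsCellFamily μ D) (hp : 0 < p.toReal)
    (hD : IsFine μ D) {a : ℕ → 𝕜} (ha : a ≠ 0) {f g : X → 𝕜} {M : ℝ}
    (hg : ∀ᵐ x ∂μ, ‖g x‖ ≤ M) (hf : ∀ᵐ x ∂μ, f x = blockSum p μ D a x + g x) (hpq : p < q) :
    IsNowhereLq f q μ := by
  intro U hU hUne
  obtain ⟨k, hk⟩ := Function.ne_iff.1 ha
  have hk : 0 < ‖a k‖ := norm_pos_iff.2 hk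
  have hv := inv_toReal_lt_inv_toReal hp hpq
  refine not_memLp_restrict (zero_le.trans_lt hpq).ne' fun K => ?_
  -- half of the value of the block sum survives the subtraction of the bound `M`
  obtain ⟨N₁, hN₁⟩ := Filter.eventually_atTop.1 ((tendsto_two_rpow_atTop (sub_pos.2 hv)
    p.toReal⁻¹).eventually_ge_atTop (2 * K / ‖a k‖))
  obtain ⟨N₂, hN₂⟩ := Filter.eventually_atTop.1 ((tendsto_two_rpow_atTop
    (inv_pos.2 hp) p.toReal⁻¹).eventually_ge_atTop (2 * M / ‖a k‖))
  obtain ⟨i, hi, hiU, him⟩ := hD k U hU hUne (max N₁ N₂)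
  have h1 := (hN₁ i ((le_max_left _ _).trans hi)).trans (h.le_weight_mul_rpow_of_le him hv.le)
  have h2 : 2 * M / ‖a k‖ ≤ weight p μ D (k, i) := by
    have := h.le_weight_mul_rpow_of_le him (v := 0) (inv_pos.2 hp).le
    rw [Real.rpow_zero, mul_one, sub_zero] at this
    exact (hN₂ i ((le_max_right _ _).trans hi)).trans this
  rw [div_le_iff₀ hk] at h1 h2
  have hw := h.weight_pos (p := p) (k, i)
  refine ⟨D (k, i), hiU, ‖a k‖ / 2 * weight p μ D (k, i), h.measurableSet _, h.pos _, h.lt_top _,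
    by positivity, ?_, by linarith⟩
  filter_upwards [hg, hf] with x hgx hfx hx
  have h3 := norm_blockSum_of_mem (p := p) h a hx
  have h4 := norm_sub_le (blockSum p μ D a x + g x) (g x)
  rw [add_sub_cancel_right, ← hfx] at h4
  dsimp only at h3
  linarith

theorem not_memLp_of_isCoarse (h : IsCellFamily μ D) (hp : p < ∞) (hD : IsCoarse μ D)
    {a : ℕ → 𝕜} (ha : a ≠ 0) {f : X → 𝕜} (hf : f =ᵐ[μ] blockSum p μ D a) (hq : 0 < q)
    (hqp : q < p) : ¬ MemLp f q μ := by
  obtain ⟨k, hk⟩ := Function.ne_iff.1 ha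
  have hk : 0 < ‖a k‖ := norm_pos_iff.2 hk
  have hqr : 0 < q.toReal := ENNReal.toReal_pos hq.ne' (hqp.trans hp).ne
  have hv : p.toReal⁻¹ < 1 / q.toReal := by
    rw [one_div]
    exact inv_strictAnti₀ hqr (ENNReal.toReal_strict_mono hp.ne hqp)
  rw [← Measure.restrict_univ (μ := μ)]
  refine not_memLp_restrict hq.ne' fun K => ?_
  obtain ⟨N, hN⟩ := Filter.eventually_atTop.1 ((tendsto_two_rpow_atTop (sub_pos.2 hv)
    p.toReal⁻¹).eventually_ge_atTop (K / ‖a k‖))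
  obtain ⟨i, hi, him⟩ := hD k N
  have h1 := (hN i hi).trans (h.le_weight_mul_rpow_of_ge him hv.le)
  rw [div_le_iff₀ hk] at h1
  have hw := h.weight_pos (p := p) (k, i)
  refine ⟨D (k, i), subset_univ _, ‖a k‖ * weight p μ D (k, i), h.measurableSet _, h.pos _,
    h.lt_top _, by positivity, ?_, by linarith⟩
  filter_upwards [hf] with x hfx hx
  rw [hfx, norm_blockSum_of_mem h a hx]

end NonIntegrability

/-! ### Existence of the cell families -/

section Existence

/-- The choice of base set for the cell with code `j`: only the even cells of a block are required
to be small, and `i / 2` encodes the index of a base set together with a repetition number. -/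
def baseIndex (j : ℕ) : ℕ := (Nat.unpair ((Nat.unpair j).2 / 2)).1

theorem exists_even_of_piBase {X : Type*} [TopologicalSpace X] {U : ℕ → Set X}
    (hU : ∀ A : Set X, IsOpen A → A.Nonempty → ∃ n, U n ⊆ A) (k : ℕ) {A : Set X} (hA : IsOpen A)
    (hA' : A.Nonempty) (N : ℕ) : ∃ i ≥ N, Even i ∧ U (baseIndex (Nat.pair k i)) ⊆ A := by
  obtain ⟨n, hn⟩ := hU A hA hA'
  refine ⟨2 * Nat.pair n N, (Nat.right_le_pair n N).trans (by omega), even_two_mul _, ?_⟩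
  rwa [baseIndex, Nat.unpair_pair, Nat.mul_div_cancel_left _ (by norm_num), Nat.unpair_pair]

theorem pairwise_disjoint_comp_pair {X : Type*} {D : ℕ → Set X}
    (hd : Pairwise (Function.onFun Disjoint D)) :
    Pairwise (Function.onFun Disjoint fun j : ℕ × ℕ => D (Nat.pair j.1 j.2)) := fun _ _ hij =>
  hd fun e => hij (Prod.ext_iff.2 (Nat.pair_eq_pair.1 e))

theorem inv_two_pow_sq_le {i j : ℕ} (h : i ≤ j) : (2⁻¹ : ℝ≥0∞) ^ j ^ 2 ≤ 2⁻¹ ^ i ^ 2 :=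
  pow_le_pow_of_le_one zero_le (by simp) (Nat.pow_le_pow_left h 2)

theorem two_pow_sq_le {i j : ℕ} (h : i ≤ j) : (2 : ℝ≥0∞) ^ i ^ 2 ≤ 2 ^ j ^ 2 :=
  pow_le_pow_right₀ (by norm_num) (Nat.pow_le_pow_left h 2)

variable {X : Type*} [MeasurableSpace X] {μ : Measure X}

theorem exists_isCoarse
    (hμ : ∀ A, MeasurableSet A → μ A = ∞ → ∀ M < ∞, ∃ B ⊆ A, MeasurableSet B ∧ M < μ B ∧ μ B < ∞)
    (hinf : μ univ = ∞) : ∃ D : ℕ × ℕ → Set X, IsCellFamily μ D ∧ IsCoarse μ D := by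
  obtain ⟨D, hD, hd, h⟩ := exists_disjoint_ge hμ .univ hinf (M := fun n => 2 ^ n ^ 2)
    fun n => by simp
  refine ⟨fun j => D (Nat.pair j.1 j.2), ⟨fun j => hD _, pairwise_disjoint_comp_pair hd,
    fun j => zero_le.trans_lt (h _).2.1, fun j => (h _).2.2⟩, fun k N => ⟨N, le_rfl, ?_⟩⟩
  exact (two_pow_sq_le (Nat.right_le_pair k N)).trans (h _).2.1.le

variable [TopologicalSpace X] [BorelSpace X]

/-- A disjoint sequence of small cells, the `n`-th of them inside the base set `U (r n)`. If `r` takes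
every value infinitely often, every nonempty open set contains cells of arbitrarily large index. -/
theorem exists_small_cells (hμ : IsAtomless μ) [μ.IsOpenPosMeasure] {U : ℕ → Set X}
    (hU : ∀ n, IsOpen (U n) ∧ (U n).Nonempty) (r : ℕ → ℕ) :
    ∃ D : ℕ → Set X, (∀ n, MeasurableSet (D n)) ∧ Pairwise (Function.onFun Disjoint D) ∧
      ∀ n, D n ⊆ U (r n) ∧ 0 < μ (D n) ∧ μ (D n) ≤ 2⁻¹ ^ n ^ 2 ∧ μ (D n) < ∞ :=
  hμ.exists_disjoint_le (fun n => (hU (r n)).1.measurableSet)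
    (fun n => (hU (r n)).1.measure_pos μ (hU (r n)).2)
    fun n => ENNReal.pow_pos (by simp) _

theorem exists_isFine (hX : HasCountablePiBase X) (hμ : IsAtomless μ) [μ.IsOpenPosMeasure] :
    ∃ D : ℕ × ℕ → Set X, IsCellFamily μ D ∧ IsFine μ D := by
  obtain ⟨U, hU, hUb⟩ := hX
  obtain ⟨D, hD, hd, h⟩ := exists_small_cells hμ hU baseIndex
  refine ⟨fun j => D (Nat.pair j.1 j.2), ⟨fun j => hD _, pairwise_disjoint_comp_pair hd,
    fun j => (h _).2.1, fun j => (h _).2.2.2⟩, fun k A hA hA' N => ?_⟩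
  obtain ⟨i, hi, -, hiA⟩ := exists_even_of_piBase hUb k hA hA' N
  exact ⟨i, hi, (h _).1.trans hiA, (h _).2.2.1.trans (inv_two_pow_sq_le (Nat.right_le_pair k i))⟩

/-- The union of the small cells has finite measure, which leaves room for the large ones. -/
theorem exists_isFine_isCoarse (hX : HasCountablePiBase X) (hμ : IsAtomless μ)
    [μ.IsOpenPosMeasure] (hinf : μ univ = ∞) :
    ∃ D : ℕ × ℕ → Set X, IsCellFamily μ D ∧ IsFine μ D ∧ IsCoarse μ D := by
  obtain ⟨U, hU, hUb⟩ := hX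
  obtain ⟨D, hD, hd, h⟩ := exists_small_cells hμ hU baseIndex
  have hDm : MeasurableSet (⋃ n, D n) := .iUnion hD
  have hDf : μ (⋃ n, D n) < ∞ := by
    calc μ (⋃ n, D n) ≤ ∑' n, μ (D n) := measure_iUnion_le _
      _ ≤ ∑' n : ℕ, (2⁻¹ : ℝ≥0∞) ^ n := ENNReal.tsum_le_tsum fun n => (h n).2.2.1.trans
          (pow_le_pow_of_le_one zero_le (by simp) (Nat.le_self_pow (by norm_num) n))
      _ < ∞ := by rw [ENNReal.tsum_geometric, ENNReal.one_sub_inv_two]; simp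
  have hinf' : μ (⋃ n, D n)ᶜ = ∞ := by
    rw [compl_eq_univ_sdiff, measure_sdiff (subset_univ _) hDm.nullMeasurableSet hDf.ne, hinf]
    exact ENNReal.top_sub hDf.ne
  obtain ⟨E, hE, hEd, hE'⟩ := exists_disjoint_ge
    (fun A hA hA' M hM => hμ.exists_lt_measure_lt_top hA hA' hM) hDm.compl hinf'
    (M := fun n => 2 ^ n ^ 2) fun n => by simp
  have hDE : ∀ m n, Disjoint (D m) (E n) := fun m n => Set.disjoint_left.2 fun x hx hx' =>
    (hE' n).1 hx' (mem_iUnion.2 ⟨m, hx⟩)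
  have hdp := pairwise_disjoint_comp_pair hd
  have hEdp := pairwise_disjoint_comp_pair hEd
  refine ⟨fun j => if Even j.2 then D (Nat.pair j.1 j.2) else E (Nat.pair j.1 j.2),
    ⟨fun j => ?_, fun i j hij => ?_, fun j => ?_, fun j => ?_⟩, fun k A hA hA' N => ?_,
    fun k N => ?_⟩
  · change MeasurableSet (if _ then _ else _)
    split_ifs
    exacts [hD _, hE _]
  · change Disjoint (if _ then _ else _) (if _ then _ else _)
    split_ifs
    exacts [hdp hij, hDE _ _, (hDE _ _).symm, hEdp hij]
  · change 0 < μ (if _ then _ else _)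
    split_ifs
    exacts [(h _).2.1, zero_le.trans_lt (hE' _).2.1]
  · change μ (if _ then _ else _) < ∞
    split_ifs
    exacts [(h _).2.2.2, (hE' _).2.2]
  · obtain ⟨i, hi, hie, hiA⟩ := exists_even_of_piBase hUb k hA hA' N
    refine ⟨i, hi, ?_⟩
    simp only [if_pos hie]
    exact ⟨(h _).1.trans hiA, (h _).2.2.1.trans (inv_two_pow_sq_le (Nat.right_le_pair k i))⟩
  · refine ⟨2 * N + 1, by omega, ?_⟩
    have hodd : ¬ Even (2 * N + 1) := by simp
    simp only [if_neg hodd]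
    exact (two_pow_sq_le (Nat.right_le_pair k _)).trans (hE' _).2.1.le

end Existence

/-! ### Isometric copies of the sequence space -/

section SeqSpace

variable {X : Type*} [MeasurableSpace X] {𝕜 : Type*} [RCLike 𝕜] {p : ℝ≥0∞} {μ : Measure X}
  {D : ℕ × ℕ → Set X}

theorem coe_ne_zero_of_ne_zero {a : lp (fun _ : ℕ => 𝕜) p} (ha : a ≠ 0) : (a : ℕ → 𝕜) ≠ 0 :=
  fun h => ha (lp.ext h)

theorem blockEmbedding_mem_S [TopologicalSpace X] (h : IsCellFamily μ D) (hp : 0 < p.toReal)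
    (hD : IsFine μ D) {a : lp (fun _ : ℕ => 𝕜) p} (ha : a ≠ 0) :
    blockEmbedding h hp a ∈ S 𝕜 p μ := fun q hpq =>
  isNowhereLq_of_isFine h hp hD (coe_ne_zero_of_ne_zero ha) (g := 0) (M := 0) (by simp)
    ((coeFn_blockEmbedding h hp a).mono fun x hx => by simpa using hx) hpq

theorem blockEmbedding_mem_LpDiffLower (h : IsCellFamily μ D) (hp : 0 < p.toReal)
    (hD : IsCoarse μ D) {a : lp (fun _ : ℕ => 𝕜) p} (ha : a ≠ 0) :
    blockEmbedding h hp a ∈ LpDiffLower 𝕜 p μ := fun _ hq hqp =>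
  not_memLp_of_isCoarse h (ENNReal.toReal_pos_iff.1 hp).2 hD (coe_ne_zero_of_ne_zero ha)
    (coeFn_blockEmbedding h hp a) hq hqp

end SeqSpace

/-! ### A dense subspace of maximal dimension -/

section Dense

variable {X : Type*} [MeasurableSpace X] {𝕜 : Type*} [RCLike 𝕜] {p : ℝ≥0∞} {μ : Measure X}

/-- The quasi-triangle inequality in `L^p`, for all `p`. -/
theorem exists_norm_add_le (𝕜 : Type*) [RCLike 𝕜] (p : ℝ≥0∞) (μ : Measure X) :
    ∃ C : ℝ, 0 < C ∧ ∀ f g : Lp 𝕜 p μ, ‖f + g‖ ≤ C * (‖f‖ + ‖g‖) := by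
  refine ⟨p.LpAddConst.toReal + 1, by positivity, fun f g => ?_⟩
  have hf := Lp.eLpNorm_ne_top f
  have hg := Lp.eLpNorm_ne_top g
  have hC := (ENNReal.LpAddConst_lt_top p).ne
  have h1 : ‖f + g‖ ≤ p.LpAddConst.toReal * (‖f‖ + ‖g‖) := by
    rw [Lp.norm_def, Lp.norm_def, Lp.norm_def, eLpNorm_congr_ae (Lp.coeFn_add f g),
      ← ENNReal.toReal_add hf hg, ← ENNReal.toReal_mul]
    exact ENNReal.toReal_mono (ENNReal.mul_ne_top hC (ENNReal.add_ne_top.2 ⟨hf, hg⟩))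
      (eLpNorm_add_le' (Lp.aestronglyMeasurable f) (Lp.aestronglyMeasurable g) p)
  have h2 : 0 ≤ ‖f‖ + ‖g‖ := add_nonneg ENNReal.toReal_nonneg ENNReal.toReal_nonneg
  linarith

theorem exists_norm_sub_le (𝕜 : Type*) [RCLike 𝕜] (p : ℝ≥0∞) (μ : Measure X) :
    ∃ C : ℝ, 0 < C ∧ ∀ f g : Lp 𝕜 p μ, ‖f - g‖ ≤ C * (‖f‖ + ‖g‖) := by
  obtain ⟨C, hC, h⟩ := exists_norm_add_le 𝕜 p μ
  refine ⟨C, hC, fun f g => ?_⟩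
  rw [sub_eq_add_neg, ← Lp.norm_neg g]
  exact h f (-g)

/-- A dense set of cardinality at most the continuum bounds the cardinality of the whole space: a
point is determined by a sequence of approximations. -/
theorem mk_Lp_le_continuum (hp : 0 < p) {E : Set (Lp 𝕜 p μ)} (hE : #E ≤ 𝔠)
    (hd : IsDenseInLp E) : #(Lp 𝕜 p μ) ≤ 𝔠 := by
  obtain ⟨C, hC, hadd⟩ := exists_norm_sub_le 𝕜 p μ
  choose d hdE hd using fun (f : Lp 𝕜 p μ) (n : ℕ) =>
    hd f (1 / ((n : ℝ) + 1)) Nat.one_div_pos_of_nat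
  have hinj : Function.Injective fun f : Lp 𝕜 p μ => fun n : ℕ => (⟨d f n, hdE f n⟩ : E) := by
    intro f g hfg
    have hfg' : ∀ n, d f n = d g n := fun n => congrArg Subtype.val (congrFun hfg n)
    have hle : ∀ n : ℕ, ‖f - g‖ ≤ 2 * C * (1 / ((n : ℝ) + 1)) := by
      intro n
      have h1 := hadd (f - d f n) (g - d g n)
      rw [hfg', sub_sub_sub_cancel_right] at h1
      have h2 := hd f n
      have h3 := hd g n
      rw [hfg'] at h2
      nlinarith
    have h0 : ‖f - g‖ ≤ 0 := by
      refine ge_of_tendsto' (x := Filter.atTop) ?_ hle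
      simpa using (tendsto_one_div_add_atTop_nhds_zero_nat (𝕜 := ℝ)).const_mul (2 * C)
    exact sub_eq_zero.1 ((Lp.norm_eq_zero_iff hp).1 (le_antisymm h0 ENNReal.toReal_nonneg))
  calc #(Lp 𝕜 p μ) ≤ #(ℕ → E) := Cardinal.mk_le_of_injective hinj
    _ = #E ^ ℵ₀ := by simp
    _ ≤ 𝔠 ^ ℵ₀ := Cardinal.power_le_power_right hE
    _ = 𝔠 := Cardinal.continuum_power_aleph0

theorem exists_bounded_norm_sub_lt (hp : p ≠ ∞) (f : Lp 𝕜 p μ) {ε : ℝ} (hε : 0 < ε) :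
    ∃ g : Lp 𝕜 p μ, (∃ M : ℝ, ∀ᵐ x ∂μ, ‖g x‖ ≤ M) ∧ ‖f - g‖ < ε := by
  obtain ⟨g, hg, hgm⟩ := (Lp.memLp f).exists_simpleFunc_eLpNorm_sub_lt hp
    (ε := ENNReal.ofReal ε) (by simpa using hε)
  refine ⟨hgm.toLp, ?_, ?_⟩
  · obtain ⟨M, hM⟩ := g.exists_forall_norm_le
    exact ⟨M, hgm.coeFn_toLp.mono fun x hx => by rw [hx]; exact hM x⟩
  · rw [Lp.norm_def, eLpNorm_congr_ae ((Lp.coeFn_sub f hgm.toLp).trans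
      (Filter.EventuallyEq.rfl.sub hgm.coeFn_toLp))]
    exact (ENNReal.toReal_lt_of_lt_ofReal hg)

/-- The elements of `L^p` that are essentially bounded. -/
def boundedSubmodule (𝕜 : Type*) [RCLike 𝕜] (p : ℝ≥0∞) (μ : Measure X) :
    Submodule 𝕜 (Lp 𝕜 p μ) where
  carrier := {f | ∃ M : ℝ, ∀ᵐ x ∂μ, ‖f x‖ ≤ M}
  zero_mem' := ⟨0, (Lp.coeFn_zero 𝕜 p μ).mono fun x hx => (norm_eq_zero.2 hx).le⟩
  add_mem' := by
    rintro f g ⟨M, hM⟩ ⟨N, hN⟩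
    refine ⟨M + N, ?_⟩
    filter_upwards [hM, hN, Lp.coeFn_add f g] with x h1 h2 h3
    rw [h3]
    exact (norm_add_le _ _).trans (add_le_add h1 h2)
  smul_mem' := by
    rintro c f ⟨M, hM⟩
    refine ⟨‖c‖ * M, ?_⟩
    filter_upwards [hM, Lp.coeFn_smul c f] with x h1 h2
    rw [h2, Pi.smul_apply, norm_smul]
    gcongr

/-- The geometric sequence with ratio `t ∈ (0, 1)`, an element of every `ℓ_p`. -/
noncomputable def geometricSeq (𝕜 : Type*) [RCLike 𝕜] (hp : 0 < p.toReal) (t : Ioo (0 : ℝ) 1) :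
    lp (fun _ : ℕ => 𝕜) p :=
  ⟨fun i => ((t : ℝ) : 𝕜) ^ i, by
    refine (memℓp_gen_iff hp).2 ((summable_geometric_of_lt_one (r := (t : ℝ) ^ p.toReal)
      (by have := t.2.1; positivity) (Real.rpow_lt_one t.2.1.le t.2.2 hp)).congr fun i => ?_)
    rw [norm_pow, RCLike.norm_ofReal, abs_of_pos t.2.1, ← Real.rpow_natCast, ← Real.rpow_natCast,
      ← Real.rpow_mul t.2.1.le, ← Real.rpow_mul t.2.1.le, mul_comm]⟩

/-- Distinct geometric sequences are distinct characters of the monoid `ℕ`. -/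
theorem linearIndependent_geometricSeq (hp : 0 < p.toReal) :
    LinearIndependent 𝕜 (geometricSeq 𝕜 hp) := by
  have h1 := (linearIndependent_monoidHom (Multiplicative ℕ) 𝕜).comp
    (fun t : Ioo (0 : ℝ) 1 => powersHom 𝕜 ((t : ℝ) : 𝕜)) (fun s t hst =>
      Subtype.ext (RCLike.ofReal_injective ((powersHom 𝕜).injective hst)))
  let L : lp (fun _ : ℕ => 𝕜) p →ₗ[𝕜] (Multiplicative ℕ → 𝕜) :=
    { toFun := fun a i => a (Multiplicative.toAdd i)
      map_add' := fun _ _ => rfl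
      map_smul' := fun _ _ => rfl }
  refine LinearIndependent.of_comp L ?_
  have h2 : ⇑L ∘ geometricSeq 𝕜 hp
      = (fun f : Multiplicative ℕ →* 𝕜 => (f : Multiplicative ℕ → 𝕜)) ∘
        fun t : Ioo (0 : ℝ) 1 => powersHom 𝕜 ((t : ℝ) : 𝕜) := by
    funext t i
    simp only [Function.comp_apply, powersHom_apply]
    rfl
  rw [h2]
  exact h1

theorem exists_surjective_of_mk_le {α : Type*} [Nonempty α] (h : #α ≤ 𝔠) :
    ∃ s : Ioo (0 : ℝ) 1 → α, Function.Surjective s := by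
  have h1 : Cardinal.lift.{0} #α ≤ Cardinal.lift #(Ioo (0 : ℝ) 1) := by
    rw [Cardinal.mk_Ioo_real zero_lt_one, Cardinal.lift_continuum, Cardinal.lift_id'.{0}]
    exact h
  obtain ⟨e⟩ := Cardinal.lift_mk_le'.1 h1
  exact ⟨Function.invFun e, Function.invFun_surjective e.injective⟩

variable [TopologicalSpace X] {D : ℕ × ℕ → Set X}

/-- Perturb a dense family of bounded functions by small linearly independent block sums. A
nontrivial combination of the perturbed functions is the sum of a bounded function and a nonzero
block sum. -/
theorem isMaximalDimensionDenseLineable_S (h : IsCellFamily μ D) (hp : 0 < p.toReal)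
    (hD : IsFine μ D) {E : Set (Lp 𝕜 p μ)} (hE : #E ≤ 𝔠) (hd : IsDenseInLp E) :
    IsMaximalDimensionDenseLineable (S 𝕜 p μ) := by
  obtain ⟨hp0, hpt⟩ := ENNReal.toReal_pos_iff.1 hp
  have hXne : (univ : Set X).Nonempty :=
    (nonempty_of_measure_ne_zero (h.pos (0, 0)).ne').mono (subset_univ _)
  have : Nonempty E := by
    obtain ⟨g, hg, -⟩ := hd 0 1 one_pos
    exact ⟨⟨g, hg⟩⟩
  obtain ⟨s, hs⟩ := exists_surjective_of_mk_le (α := E × ℕ) (by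
    rw [Cardinal.mk_prod, Cardinal.lift_id'.{0}, Cardinal.mk_nat, Cardinal.lift_aleph0]
    exact (mul_le_mul_left hE _).trans Cardinal.continuum_mul_aleph0.le)
  choose γ hγb hγ using fun t : Ioo (0 : ℝ) 1 => exists_bounded_norm_sub_lt hpt.ne (s t).1.1
    (ε := 1 / (((s t).2 : ℝ) + 1)) Nat.one_div_pos_of_nat
  -- the scaling factors that make the perturbations small
  let c : Ioo (0 : ℝ) 1 → ℝ := fun t =>
    1 / (((s t).2 : ℝ) + 1) / (‖geometricSeq 𝕜 hp t‖ + 1)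
  have hg0 : ∀ t, 0 < ‖geometricSeq 𝕜 hp t‖ + 1 := fun t => by
    have := lp.norm_nonneg' (geometricSeq 𝕜 hp t)
    linarith
  have hc : ∀ t, 0 < c t := fun t => div_pos Nat.one_div_pos_of_nat (hg0 t)
  let y : Ioo (0 : ℝ) 1 → lp (fun _ : ℕ => 𝕜) p := fun t => (c t : 𝕜) • geometricSeq 𝕜 hp t
  have hy : LinearIndependent 𝕜 y :=
    (linearIndependent_geometricSeq hp).units_smul fun t =>
      Units.mk0 (c t : 𝕜) (RCLike.ofReal_ne_zero.2 (hc t).ne')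
  have hyn : ∀ t, ‖y t‖ ≤ 1 / (((s t).2 : ℝ) + 1) := by
    intro t
    have h1 : ‖y t‖ ≤ c t * ‖geometricSeq 𝕜 hp t‖ := by
      have := lp.norm_const_smul_le hp0.ne' (c t : 𝕜) (geometricSeq 𝕜 hp t)
      rwa [RCLike.norm_ofReal, abs_of_pos (hc t)] at this
    have h2 : c t * (‖geometricSeq 𝕜 hp t‖ + 1) = 1 / (((s t).2 : ℝ) + 1) :=
      div_mul_cancel₀ _ (hg0 t).ne'
    have := hc t
    linarith
  let v : Ioo (0 : ℝ) 1 → Lp 𝕜 p μ := fun t => γ t + blockEmbedding h hp (y t)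
  have hcomb : ∀ l : Ioo (0 : ℝ) 1 →₀ 𝕜, Finsupp.linearCombination 𝕜 v l
      = Finsupp.linearCombination 𝕜 γ l
        + blockEmbedding h hp (Finsupp.linearCombination 𝕜 y l) := by
    intro l
    rw [Finsupp.apply_linearCombination]
    simp only [Finsupp.linearCombination_apply, Finsupp.sum, v, smul_add,
      Finset.sum_add_distrib, Function.comp_apply]
  have hS : ∀ l : Ioo (0 : ℝ) 1 →₀ 𝕜, l ≠ 0 → Finsupp.linearCombination 𝕜 v l ∈ S 𝕜 p μ := by
    intro l hl
    have hl' : Finsupp.linearCombination 𝕜 y l ≠ 0 := fun h0 =>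
      hl ((linearIndependent_iff.1 hy) l h0)
    have hb : Finsupp.linearCombination 𝕜 γ l ∈ boundedSubmodule 𝕜 p μ := by
      rw [Finsupp.linearCombination_apply]
      exact Submodule.sum_mem _ fun t _ => Submodule.smul_mem _ _ (hγb t)
    obtain ⟨M, hM⟩ := hb
    intro q hpq
    refine isNowhereLq_of_isFine h hp hD (coe_ne_zero_of_ne_zero hl') hM ?_ hpq
    rw [hcomb]
    filter_upwards [Lp.coeFn_add (Finsupp.linearCombination 𝕜 γ l) (blockEmbedding h hp
      (Finsupp.linearCombination 𝕜 y l)), coeFn_blockEmbedding h hp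
      (Finsupp.linearCombination 𝕜 y l)] with x h1 h2
    rw [h1, Pi.add_apply, h2, add_comm]
  have h0S : (0 : Lp 𝕜 p μ) ∉ S 𝕜 p μ := fun h0 =>
    h0 ∞ hpt univ isOpen_univ hXne
      ((memLp_congr_ae (ae_restrict_of_ae (Lp.coeFn_zero 𝕜 p μ))).2 MemLp.zero')
  have hv : LinearIndependent 𝕜 v := by
    refine linearIndependent_iff.2 fun l hl => ?_
    by_contra hne
    exact h0S (hl ▸ hS l hne)
  have hrank : Module.rank 𝕜 (Submodule.span 𝕜 (range v)) = 𝔠 := by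
    rw [rank_span hv]
    have := Cardinal.mk_range_eq_of_injective hv.injective
    rw [Cardinal.mk_Ioo_real zero_lt_one, Cardinal.lift_continuum] at this
    exact (by simpa using this.symm : 𝔠 = #(range v)).symm
  refine ⟨Submodule.span 𝕜 (range v), ?_, ?_, ?_, le_antisymm (Submodule.rank_le _) ?_⟩
  · intro f hf
    obtain ⟨l, rfl⟩ := (Finsupp.mem_span_range_iff_exists_finsupp).1 hf
    by_cases hl : l = 0
    · exact Or.inr (by simp [hl])
    · exact Or.inl (hS l hl)
  · intro f ε hε
    obtain ⟨C, hC, hadd⟩ := exists_norm_sub_le 𝕜 p μ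
    obtain ⟨C', hC', hadd'⟩ := exists_norm_add_le 𝕜 p μ
    obtain ⟨n, hn⟩ := exists_nat_one_div_lt (div_pos hε (by positivity : 0 < C' * (1 + 2 * C)))
    obtain ⟨d, hdE, hfd⟩ := hd f (1 / ((n : ℝ) + 1)) Nat.one_div_pos_of_nat
    obtain ⟨t, ht⟩ := hs (⟨d, hdE⟩, n)
    refine ⟨v t, Submodule.subset_span ⟨t, rfl⟩, ?_⟩
    have h1 := hγ t
    have h2 := hyn t
    rw [ht] at h1 h2
    have h3 := hadd (d - γ t) (blockEmbedding h hp (y t))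
    rw [norm_blockEmbedding] at h3
    have h4 := hadd' (f - d) (d - γ t - blockEmbedding h hp (y t))
    rw [show f - d + (d - γ t - blockEmbedding h hp (y t)) = f - v t by
      simp only [v]; abel] at h4
    rw [lt_div_iff₀ (by positivity)] at hn
    calc ‖f - v t‖ ≤ C' * (‖f - d‖ + ‖d - γ t - blockEmbedding h hp (y t)‖) := h4
      _ ≤ C' * (1 / ((n : ℝ) + 1) + C * (1 / ((n : ℝ) + 1) + 1 / ((n : ℝ) + 1))) := by
        gcongr
        exact h3.trans (by gcongr)
      _ = 1 / ((n : ℝ) + 1) * (C' * (1 + 2 * C)) := by ring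
      _ < ε := hn
  · rw [hrank]
    exact Cardinal.aleph0_le_continuum
  · rw [hrank]
    exact (rank_le_card 𝕜 _).trans (mk_Lp_le_continuum hp0 hE hd)

end Dense

/-! ### Exponentials of a fast growing step function -/

section Exponentials

open scoped NNReal

variable (𝕜 : Type*) [RCLike 𝕜]

/-- The values of the function that is `exp (s * j)` on the `j`-th cell and, outside the cells, is
`0` for `s > 0` and `1` for `s = 0`. This is multiplicative in `s ≥ 0`. -/
noncomputable def expChar : Multiplicative ℝ≥0 →* (Option ℕ → 𝕜) where
  toFun s o := o.elim (if s.toAdd = 0 then 1 else 0) fun j => (Real.exp (s.toAdd * j) : 𝕜)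
  map_one' := by
    funext o
    cases o <;> simp
  map_mul' s t := by
    funext o
    cases o with
    | none => by_cases hs : s.toAdd = 0 <;> by_cases ht : t.toAdd = 0 <;> simp [hs, ht]
    | some j => simp [add_mul, Real.exp_add]

/-- The values of the exponential sums `∑ a s * exp (s * j)`, for finitely supported coefficients
`a`, as a homomorphism defined on the monoid algebra of the exponents. -/
noncomputable def expSum : AddMonoidAlgebra 𝕜 ℝ≥0 →ₐ[𝕜] (Option ℕ → 𝕜) :=
  AddMonoidAlgebra.lift 𝕜 (Option ℕ → 𝕜) ℝ≥0 (expChar 𝕜)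

variable {𝕜}

theorem expSum_apply (a : AddMonoidAlgebra 𝕜 ℝ≥0) (o : Option ℕ) :
    expSum 𝕜 a o = ∑ s ∈ a.coeff.support, a.coeff s * expChar 𝕜 (.ofAdd s) o := by
  rw [expSum, AddMonoidAlgebra.lift_apply, Finsupp.sum, Finset.sum_apply]
  rfl

theorem expSum_none (a : AddMonoidAlgebra 𝕜 ℝ≥0) : expSum 𝕜 a none = a.coeff 0 := by
  rw [expSum_apply]
  simpa [expChar] using fun h : a.coeff 0 = 0 => h.symm

/-- The term with the largest exponent dominates. -/
theorem exists_le_norm_expSum {a : AddMonoidAlgebra 𝕜 ℝ≥0} (ha : a ≠ 0) :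
    ∃ s : ℝ≥0, a.coeff s ≠ 0 ∧ ∃ c : ℝ, 0 < c ∧
      ∀ᶠ j : ℕ in Filter.atTop, c * Real.exp (s * j) ≤ ‖expSum 𝕜 a (some j)‖ := by
  have hne : a.coeff.support.Nonempty := Finsupp.support_nonempty_iff.2
    (AddMonoidAlgebra.coeff_eq_zero.not.2 ha)
  set s := a.coeff.support.max' hne with hs
  have hsm : s ∈ a.coeff.support := a.coeff.support.max'_mem hne
  have has : a.coeff s ≠ 0 := Finsupp.mem_support_iff.1 hsm
  refine ⟨s, has, ‖a.coeff s‖ / 2, by positivity, ?_⟩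
  have h1 : Filter.Tendsto (fun j : ℕ => ∑ t ∈ a.coeff.support,
      a.coeff t * ((Real.exp ((t - s) * j) : ℝ) : 𝕜)) Filter.atTop
      (nhds (∑ t ∈ a.coeff.support, if t = s then a.coeff s else 0)) := by
    refine tendsto_finsetSum _ fun t ht => ?_
    by_cases hts : t = s
    · simp [hts]
    · rw [if_neg hts]
      have hlt : (t : ℝ) - s < 0 :=
        sub_neg.2 (NNReal.coe_lt_coe.2 (lt_of_le_of_ne (a.coeff.support.le_max' t ht) hts))
      have h2 : Filter.Tendsto (fun j : ℕ => Real.exp (((t : ℝ) - s) * j)) Filter.atTop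
          (nhds 0) :=
        Real.tendsto_exp_atBot.comp (tendsto_natCast_atTop_atTop.const_mul_atTop_of_neg hlt)
      have h3 := ((RCLike.continuous_ofReal (K := 𝕜)).tendsto 0).comp h2
      simpa using h3.const_mul (a.coeff t)
  rw [Finset.sum_ite_eq' a.coeff.support s, if_pos hsm] at h1
  have h4 := h1.norm.eventually_const_le (half_lt_self (norm_pos_iff.2 has))
  filter_upwards [h4] with j hj
  have h5 : expSum 𝕜 a (some j)
      = (∑ t ∈ a.coeff.support, a.coeff t * ((Real.exp ((t - s) * j) : ℝ) : 𝕜))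
        * ((Real.exp (s * j) : ℝ) : 𝕜) := by
    rw [expSum_apply, Finset.sum_mul]
    refine Finset.sum_congr rfl fun t _ => ?_
    rw [mul_assoc, ← RCLike.ofReal_mul, ← Real.exp_add]
    simp only [expChar, MonoidHom.coe_mk, OneHom.coe_mk, Option.elim_some, toAdd_ofAdd]
    congr 3
    ring
  rw [h5, norm_mul, RCLike.norm_ofReal, abs_of_pos (Real.exp_pos _)]
  gcongr

theorem summable_exp_mul_inv_two_pow (u : ℝ) :
    Summable fun j : ℕ => Real.exp (u * j) * (2⁻¹ : ℝ) ^ j ^ 2 := by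
  have h1 : Filter.Tendsto (fun j : ℕ => Real.exp u * (2⁻¹ : ℝ) ^ j) Filter.atTop (nhds 0) := by
    simpa using (tendsto_pow_atTop_nhds_zero_of_lt_one (r := (2⁻¹ : ℝ)) (by norm_num)
      (by norm_num)).const_mul (Real.exp u)
  refine Summable.of_norm_bounded_eventually_nat
    (summable_geometric_of_lt_one (r := (2⁻¹ : ℝ)) (by norm_num) (by norm_num)) ?_
  filter_upwards [h1.eventually_le_const (show (0 : ℝ) < 2⁻¹ by norm_num)] with j hj
  have h2 : Real.exp (u * j) * (2⁻¹ : ℝ) ^ j ^ 2 = (Real.exp u * (2⁻¹ : ℝ) ^ j) ^ j := by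
    rw [mul_pow, ← pow_mul, ← sq, ← Real.exp_nat_mul, mul_comm u]
  rw [Real.norm_of_nonneg (by positivity), h2]
  gcongr

variable {X : Type*} [MeasurableSpace X] {μ : Measure X} {D : ℕ → Set X}

theorem memLp_expChar (hD : ∀ n, MeasurableSet (D n))
    (hd : Pairwise (Function.onFun Disjoint D)) (hle : ∀ n, μ (D n) ≤ 2⁻¹ ^ n ^ 2) {s : ℝ≥0}
    (hs : s ≠ 0) {q : ℝ≥0∞} (hq : 0 < q) (hq' : q < ∞) :
    MemLp (fun x => expChar 𝕜 (.ofAdd s) (cellIndex D x)) q μ := by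
  have hqr := ENNReal.toReal_pos hq.ne' hq'.ne
  refine ⟨(measurable_comp_cellIndex hD hd _).aestronglyMeasurable, ?_⟩
  refine (eLpNorm_lt_top_iff_lintegral_rpow_enorm_lt_top hq.ne' hq'.ne).2 ?_
  rw [lintegral_comp_cellIndex μ hD hd (F := fun o => ‖expChar 𝕜 (.ofAdd s) o‖ₑ ^ q.toReal)
    (by simp [expChar, hs, hqr])]
  refine lt_of_le_of_lt (ENNReal.tsum_le_tsum fun j => ?_)
    (summable_exp_mul_inv_two_pow (s * q.toReal)).tsum_ofReal_lt_top
  have h1 : ‖expChar 𝕜 (.ofAdd s) (some j)‖ₑ = ENNReal.ofReal (Real.exp (s * j)) := by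
    rw [← ofReal_norm]
    simp only [expChar, MonoidHom.coe_mk, OneHom.coe_mk, Option.elim_some, toAdd_ofAdd]
    rw [RCLike.norm_ofReal, abs_of_pos (Real.exp_pos _)]
  rw [h1, ENNReal.ofReal_rpow_of_nonneg (Real.exp_pos _).le hqr.le,
    ENNReal.ofReal_mul (Real.exp_pos _).le, ← Real.exp_mul, mul_right_comm]
  gcongr
  refine (hle j).trans_eq ?_
  rw [ENNReal.ofReal_pow (by norm_num), ENNReal.ofReal_inv_of_pos (by norm_num)]
  norm_num

/-- Values on the cells define classes of measurable functions, compatibly with the algebra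
operations. -/
noncomputable def cellHom (𝕜 : Type*) [RCLike 𝕜] (μ : Measure X) (hD : ∀ n, MeasurableSet (D n))
    (hd : Pairwise (Function.onFun Disjoint D)) : (Option ℕ → 𝕜) →ₐ[𝕜] (X →ₘ[μ] 𝕜) :=
  AlgHom.ofLinearMap
    { toFun := fun v => AEEqFun.mk (fun x => v (cellIndex D x))
        (measurable_comp_cellIndex hD hd v).aestronglyMeasurable
      map_add' := fun _ _ => rfl
      map_smul' := fun _ _ => rfl } rfl fun _ _ => rfl

theorem coeFn_cellHom (hD : ∀ n, MeasurableSet (D n))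
    (hd : Pairwise (Function.onFun Disjoint D)) (v : Option ℕ → 𝕜) :
    cellHom 𝕜 μ hD hd v =ᵐ[μ] fun x => v (cellIndex D x) :=
  AEEqFun.coeFn_mk _ (measurable_comp_cellIndex hD hd v).aestronglyMeasurable

/-- The class of the exponential sum with coefficients `a` of the step function `j` on `D j`. -/
noncomputable def expClass (𝕜 : Type*) [RCLike 𝕜] (μ : Measure X)
    (hD : ∀ n, MeasurableSet (D n)) (hd : Pairwise (Function.onFun Disjoint D)) :
    AddMonoidAlgebra 𝕜 ℝ≥0 →ₐ[𝕜] (X →ₘ[μ] 𝕜) :=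
  (cellHom 𝕜 μ hD hd).comp (expSum 𝕜)

theorem expClass_injective (hD : ∀ n, MeasurableSet (D n))
    (hd : Pairwise (Function.onFun Disjoint D)) (hpos : ∀ n, 0 < μ (D n)) :
    Function.Injective (expClass 𝕜 μ hD hd) := by
  refine (injective_iff_map_eq_zero _).2 fun a ha => ?_
  by_contra hne
  obtain ⟨s, -, c, hc, h⟩ := exists_le_norm_expSum hne
  obtain ⟨j, hj⟩ := h.exists
  have h1 : ∀ᵐ x ∂μ, expSum 𝕜 a (cellIndex D x) = 0 := by
    filter_upwards [coeFn_cellHom (μ := μ) hD hd (expSum 𝕜 a),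
      AEEqFun.coeFn_zero (β := 𝕜) (μ := μ)] with x hx hx0
    rw [← hx]
    change expClass 𝕜 μ hD hd a x = 0
    rw [ha, hx0, Pi.zero_apply]
  have h2 : μ (D j) = 0 := by
    refine measure_mono_null (t := {x | expSum 𝕜 a (cellIndex D x) = 0}ᶜ) (fun x hx hx0 => ?_) h1
    rw [mem_ofPred_eq, cellIndex_of_mem hd hx] at hx0
    rw [hx0, norm_zero] at hj
    exact absurd hj (not_le.2 (mul_pos hc (Real.exp_pos _)))
  exact (hpos j).ne' h2

variable [TopologicalSpace X]

theorem expClass_mem_G (hD : ∀ n, MeasurableSet (D n))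
    (hd : Pairwise (Function.onFun Disjoint D)) (hpos : ∀ n, 0 < μ (D n))
    (hle : ∀ n, μ (D n) ≤ 2⁻¹ ^ n ^ 2)
    (hfreq : ∀ U : Set X, IsOpen U → U.Nonempty → ∀ N, ∃ n ≥ N, D n ⊆ U)
    {a : AddMonoidAlgebra 𝕜 ℝ≥0} (ha : a ≠ 0) (ha0 : a.coeff 0 = 0) :
    expClass 𝕜 μ hD hd a ∈ G 𝕜 μ := by
  have hco : expClass 𝕜 μ hD hd a =ᵐ[μ] fun x => expSum 𝕜 a (cellIndex D x) :=
    coeFn_cellHom hD hd _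
  refine ⟨fun q hq hq' => (memLp_congr_ae hco).2 ?_, fun U hU hUne =>
    not_memLp_restrict (by simp) fun M => ?_⟩
  · simp_rw [expSum_apply]
    refine memLp_finsetSum _ fun s hs =>
      (memLp_expChar hD hd hle ?_ hq hq').const_mul (a.coeff s)
    rintro rfl
    exact Finsupp.mem_support_iff.1 hs ha0
  · obtain ⟨s, has, c, hc, h⟩ := exists_le_norm_expSum ha
    have hs : 0 < (s : ℝ) := NNReal.coe_pos.2 (pos_iff_ne_zero.2 fun h0 => has (h0 ▸ ha0))
    have hlim : Filter.Tendsto (fun j : ℕ => c * Real.exp (s * j)) Filter.atTop Filter.atTop :=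
      (Real.tendsto_exp_atTop.comp (tendsto_natCast_atTop_atTop.const_mul_atTop hs)).const_mul_atTop
        hc
    obtain ⟨N, hN⟩ := Filter.eventually_atTop.1 (h.and (hlim.eventually_ge_atTop M))
    obtain ⟨n, hn, hnU⟩ := hfreq U hU hUne N
    refine ⟨D n, hnU, ‖expSum 𝕜 a (some n)‖, hD n, hpos n,
      (hle n).trans_lt (ENNReal.pow_lt_top (by simp)), norm_nonneg _, ?_, ?_⟩
    · filter_upwards [hco] with x hx hxD
      rw [hx, cellIndex_of_mem hd hxD]
    · simpa using (hN n hn).2.trans (hN n hn).1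

/-- A Hamel basis of the reals over the rationals, made positive. -/
theorem exists_linearIndependent_nnreal :
    ∃ (ι : Type) (w : ι → ℝ≥0), #ι = 𝔠 ∧ LinearIndependent ℕ w ∧ ∀ i, w i ≠ 0 := by
  let b := Module.Basis.ofVectorSpace ℚ ℝ
  refine ⟨_, fun i => ‖b i‖₊, b.mk_eq_rank''.trans Real.rank_rat_real, ?_, fun i => by
    simpa using b.ne_zero i⟩
  have h1 : LinearIndependent ℚ fun i => |b i| := by
    have h : (fun i => |b i|) = (fun i => if 0 ≤ b i then (1 : ℚˣ) else -1) • ⇑b := by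
      funext i
      by_cases hi : 0 ≤ b i
      · simp [hi, abs_of_nonneg hi]
      · simp [hi, abs_of_neg (not_le.1 hi)]
    rw [h]
    exact b.linearIndependent.units_smul _
  have h2 : LinearIndependent ℕ fun i => |b i| :=
    h1.restrict_scalars (R := ℕ) (K := ℚ) (fun m n hmn => by simpa using hmn)
  exact LinearIndependent.of_comp (NNReal.toRealHom.toAddMonoidHom.toNatLinearMap) h2

/-- The exponentials whose exponents are independent over the rationals generate freely: their
monomials are exponentials with distinct exponents. -/
theorem isStronglyAlgebrable_G (hD : ∀ n, MeasurableSet (D n))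
    (hd : Pairwise (Function.onFun Disjoint D)) (hpos : ∀ n, 0 < μ (D n))
    (hle : ∀ n, μ (D n) ≤ 2⁻¹ ^ n ^ 2)
    (hfreq : ∀ U : Set X, IsOpen U → U.Nonempty → ∀ N, ∃ n ≥ N, D n ⊆ U) :
    IsStronglyAlgebrable 𝕜 𝔠 (G 𝕜 μ) := by
  obtain ⟨ι, w, hι, hw, hw0⟩ := exists_linearIndependent_nnreal
  let z : ι → (X →ₘ[μ] 𝕜) := fun i => expClass 𝕜 μ hD hd (AddMonoidAlgebra.single (w i) 1)
  have hz : AlgebraicIndependent 𝕜 z := by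
    let ψ : (ι →₀ ℕ) →+ ℝ≥0 := (Finsupp.linearCombination ℕ w).toAddMonoidHom
    let Ψ : MvPolynomial ι 𝕜 →ₐ[𝕜] AddMonoidAlgebra 𝕜 ℝ≥0 :=
      AddMonoidAlgebra.mapDomainAlgHom 𝕜 𝕜 ψ
    have h1 : MvPolynomial.aeval z = (expClass 𝕜 μ hD hd).comp Ψ := by
      refine MvPolynomial.algHom_ext fun i => ?_
      rw [MvPolynomial.aeval_X, AlgHom.comp_apply]
      have h2 : Ψ (MvPolynomial.X i) = AddMonoidAlgebra.single (ψ (Finsupp.single i 1)) 1 :=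
        AddMonoidAlgebra.mapDomain_single
      rw [h2]
      simp [ψ, z]
    have h3 : Function.Injective Ψ := AddMonoidAlgebra.mapDomain_injective (f := ψ) hw
    rw [AlgebraicIndependent, h1]
    exact (expClass_injective hD hd hpos).comp h3
  refine ⟨range z, ?_, hz.coe_range, fun f hf => ?_⟩
  · have h1 := Cardinal.mk_range_eq_of_injective hz.injective
    rw [hι, Cardinal.lift_continuum] at h1
    exact (by simpa using h1.symm : 𝔠 = #(range z)).symm
  · have key : ∃ a : AddMonoidAlgebra 𝕜 ℝ≥0, expSum 𝕜 a none = 0 ∧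
        expClass 𝕜 μ hD hd a = f := by
      induction hf using NonUnitalAlgebra.adjoin_induction with
      | mem x hx =>
        obtain ⟨i, rfl⟩ := hx
        refine ⟨_, ?_, rfl⟩
        rw [expSum_none]
        rw [AddMonoidAlgebra.coeff_single]
        exact Finsupp.single_eq_of_ne (hw0 i).symm
      | add x y _ _ hx hy =>
        obtain ⟨a, ha, rfl⟩ := hx
        obtain ⟨b, hb, rfl⟩ := hy
        exact ⟨a + b, by simp [ha, hb], map_add _ _ _⟩
      | zero => exact ⟨0, by simp, map_zero _⟩
      | mul x y _ _ hx hy =>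
        obtain ⟨a, ha, rfl⟩ := hx
        obtain ⟨b, hb, rfl⟩ := hy
        exact ⟨a * b, by simp [ha, hb], map_mul _ _ _⟩
      | smul r x _ hx =>
        obtain ⟨a, ha, rfl⟩ := hx
        exact ⟨r • a, by simp [ha], map_smul _ _ _⟩
    obtain ⟨a, ha, rfl⟩ := key
    by_cases h0 : a = 0
    · exact Or.inr (by simp [h0])
    · exact Or.inl (expClass_mem_G hD hd hpos hle hfreq h0 (expSum_none a ▸ ha))

end Exponentials

end NowhereLq

/-! ### Spaceability, dense lineability and algebrability -/

theorem theorem1p7 {𝕜 : Type*} [RCLike 𝕜] {X : Type*} [TopologicalSpace X] [MeasurableSpace X]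
    [BorelSpace X] (hX : NowhereLq.HasCountablePiBase X) (μ : Measure X)
    (p : ℝ≥0∞) (hp₀ : 0 < p) (hp : p < ∞) :
    -- (a)
    (NowhereLq.IsAtomless μ → μ.OuterRegular → μ.IsOpenPosMeasure →
      NowhereLq.ContainsSeqSpace (NowhereLq.S 𝕜 p μ)) ∧
    -- (b)
    (μ univ = ∞ → SigmaFinite μ →
      NowhereLq.ContainsSeqSpace (NowhereLq.LpDiffLower 𝕜 p μ)) ∧
    -- (c)
    (NowhereLq.IsAtomless μ → μ univ = ∞ → μ.OuterRegular → μ.IsOpenPosMeasure →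
      NowhereLq.ContainsSeqSpace (NowhereLq.S' 𝕜 p μ)) ∧
    -- (d)
    (NowhereLq.IsAtomless μ → μ.OuterRegular → μ.IsOpenPosMeasure →
      (∃ D : Set (Lp 𝕜 p μ), #D ≤ 𝔠 ∧ NowhereLq.IsDenseInLp D) →
      NowhereLq.IsMaximalDimensionDenseLineable (NowhereLq.S 𝕜 p μ)) ∧
    -- (e)
    (NowhereLq.IsAtomless μ → μ.OuterRegular → μ.IsOpenPosMeasure →
      NowhereLq.IsStronglyAlgebrable 𝕜 𝔠 (NowhereLq.G 𝕜 μ)) := by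
  have hpr : 0 < p.toReal := ENNReal.toReal_pos hp₀.ne' hp.ne
  refine ⟨fun hμ _ _ => ?_, fun hinf _ => ?_, fun hμ hinf _ _ => ?_, fun hμ _ _ hE => ?_,
    fun hμ _ _ => ?_⟩
  · obtain ⟨D, hD, hfine⟩ := NowhereLq.exists_isFine hX hμ
    exact NowhereLq.containsSeqSpace_of_isCellFamily hD hpr fun a ha =>
      NowhereLq.blockEmbedding_mem_S hD hpr hfine ha
  · obtain ⟨D, hD, hcoarse⟩ := NowhereLq.exists_isCoarse (μ := μ) (fun A hA hA' M hM => by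
      obtain ⟨B, hB, hBA, h1, h2⟩ := Measure.exists_subset_measure_lt_top hA (hA'.symm ▸ hM)
      exact ⟨B, hBA, hB, h1, h2⟩) hinf
    exact NowhereLq.containsSeqSpace_of_isCellFamily hD hpr fun a ha =>
      NowhereLq.blockEmbedding_mem_LpDiffLower hD hpr hcoarse ha
  · obtain ⟨D, hD, hfine, hcoarse⟩ := NowhereLq.exists_isFine_isCoarse hX hμ hinf
    exact NowhereLq.containsSeqSpace_of_isCellFamily hD hpr fun a ha =>
      ⟨NowhereLq.blockEmbedding_mem_S hD hpr hfine ha,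
        NowhereLq.blockEmbedding_mem_LpDiffLower hD hpr hcoarse ha⟩
  · obtain ⟨D, hD, hfine⟩ := NowhereLq.exists_isFine hX hμ
    obtain ⟨E, hE, hEd⟩ := hE
    exact NowhereLq.isMaximalDimensionDenseLineable_S hD hpr hfine hE hEd
  · obtain ⟨U, hU, hUb⟩ := hX
    obtain ⟨D, hD, hd, h⟩ := NowhereLq.exists_small_cells hμ hU fun n => (Nat.unpair n).1
    refine NowhereLq.isStronglyAlgebrable_G hD hd (fun n => (h n).2.1) (fun n => (h n).2.2.1)
      fun A hA hA' N => ?_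
    obtain ⟨n, hn⟩ := hUb A hA hA'
    refine ⟨Nat.pair n N, Nat.right_le_pair n N, (h _).1.trans ?_⟩
    simpa using hn
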